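/- Let $\Sigma=\{0,1\}$. For positive integers $b,c,d$, let $\mathrm{GC}(b,c,d)$ be the class of all sets $L\subseteq\Sigma^*$ for which there is a polynomial-time computable function $f$, mapping finite sets of strings to finite sets of strings, such that for every $n\ge 1$ and all distinct strings $y_1,\dots,y_n\in\Sigma^*$: 1. $f(y_1,\dots,y_n)\subseteq\{y_1,\dots,y_n\}$ and $\|f(y_1,\dots,y_n)\|\le c$; 2. if $\|L\cap\{y_1,\dots,y_n\}\|\ge b$, then $\|L\cap f(y_1,\dots,y_n)\|\ge d$. (A finite set of strings is given to, and returned by, the polynomial-time Turing machine as one binary string that encodes the list of its elements in lexicographical order, shorter strings first.) Then: 1. $\mathrm{GC}(2,3,2)\subsetneq\mathrm{GC}(1,2,1)$. 2. $\mathrm{GC}(3,3,2)$ and $\mathrm{GC}(1,2,1)$ are incomparable, i.e. $\mathrm{GC}(3,3,2)\not\subseteq\mathrm{GC}(1,2,1)$ and $\mathrm{GC}(1,2,1)\not\subseteq\mathrm{GC}(3,3,2)$. 3. $\mathrm{GC}(3,3,2)\subsetneq\mathrm{GC}(2,2,1)$. -/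

import Mathlib

namespace MultiSel

/-- Strings over the alphabet `{0, 1}`. -/
abbrev Str : Type := List Bool

/-- The lexicographical order on strings in the convention of complexity theory: shorter strings
come first, and strings of the same length are compared from left to right with `0 < 1`. -/
def StrLE (x y : Str) : Prop :=
  x.length < y.length ∨ (x.length = y.length ∧ x ≤ y)

instance : DecidableRel StrLE := fun x y => by
  unfold StrLE
  infer_instance

instance : IsTrans Str StrLE where
  trans a b c hab hbc := by
    rcases hab with h | ⟨h, h'⟩ <;> rcases hbc with k | ⟨k, k'⟩
    · exact Or.inl (h.trans k)
    · exact Or.inl (k ▸ h)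
    · exact Or.inl (h ▸ k)
    · exact Or.inr ⟨h.trans k, h'.trans k'⟩

instance : Std.Antisymm StrLE where
  antisymm a b hab hba := by
    rcases hab with h | ⟨h, h'⟩ <;> rcases hba with k | ⟨k, k'⟩
    · omega
    · omega
    · omega
    · exact le_antisymm h' k'

instance : Std.Total StrLE where
  total a b := by
    rcases lt_trichotomy a.length b.length with h | h | h
    · exact Or.inl (Or.inl h)
    · rcases le_total a b with k | k
      · exact Or.inl (Or.inr ⟨h, k⟩)
      · exact Or.inr (Or.inr ⟨h.symm, k⟩)
    · exact Or.inr (Or.inl h)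

/-- Self-delimiting binary code of one string: each bit `b` is written as `1b`, and a single `0`
marks the end of the string. -/
def encodeStr (x : Str) : Str :=
  x.flatMap (fun b => [true, b]) ++ [false]

/-- Binary code of a finite set of strings: the codes of its elements, listed in lexicographical
order, are written one after the other. -/
def encodeSet (Y : Finset Str) : Str :=
  (Y.sort StrLE).flatMap encodeStr

/-- `f` is computed by a deterministic polynomial-time transducer, that is, by a machine with
finitely many work stores over finite alphabets which, for some polynomial `p`, turns the code of
every finite set `Y` of strings into the code of `f Y` in at most `p n` steps, where `n` is the
length of the code of `Y`. -/
def IsPolyTime (f : Finset Str → Finset Str) : Prop :=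
  ∃ M : Turing.TM2ComputableInPolyTime encodeSet encodeSet f, ∀ k, Finite (M.tm.Γ k)

/-- `f` is a `GC(b, c, d)`-selector for `L`: on every nonempty finite set `Y` of input strings it
outputs at most `c` of them, and at least `d` of the output strings belong to `L` whenever at
least `b` of the input strings do. -/
def IsSelector (b c d : ℕ) (L : Set Str) (f : Finset Str → Finset Str) : Prop :=
  ∀ Y : Finset Str, Y.Nonempty →
    (f Y ⊆ Y ∧ (f Y).card ≤ c) ∧
    (b ≤ (L ∩ (Y : Set Str)).ncard → d ≤ (L ∩ (f Y : Set Str)).ncard)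

/-- The class `GC(b, c, d)` of sets of strings with a polynomial-time `GC(b, c, d)`-selector. -/
def GC (b c d : ℕ) : Set (Set Str) :=
  {L | ∃ f : Finset Str → Finset Str, IsPolyTime f ∧ IsSelector b c d L f}

end MultiSel

/-! Both inclusions are instances of `GC_succ_subset`. Fix one string `z` of `L` (if there is any).
If `z` is among the inputs, output `z` alone. Otherwise add `z` to the inputs, which raises the
number of members of `L` from `b` to `b + 1`, so that at least two of the at most three selected
strings lie in `L`. Dropping `z`, or one string if `z` was not selected and there are three, loses
at most one member and leaves at most two strings.

The two non-inclusions are diagonalisations. There are only countably many polynomial-time functions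
(`countable_isPolyTime`), and the set that is constructed need not be computable: it is read off an
infinite path built in stages, and one fixed polynomial-time selector works for all paths.

For `GC_one_two_one_not_subset` the set consists of two initial segments of the dictionary order,
one among the strings that begin with `0` and one among those that begin with `1`; the least input
on each side is a valid selection. At stage `n` three strings are offered on each side. The function
`F n` returns at most three strings, hence at most one from some side, and the path then puts
exactly the three strings of that side into the set.

For `GC_three_three_two_not_subset` the set of a path is the initial segment below it with some
strings `v0` removed, namely when the path goes through `v10`. Such sets are no longer nested, but
for `c ≤ s` the set of `c` has at most one element outside the set of `s` (`mem_sdiff_unique`). The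
inputs and their variants `alt y` form a list of thresholds that suffices to cover the members of
the unknown set (`mem_of_mem_of_le`); three strings below the least threshold that captures three
inputs contain at most one error. On the other hand, the path can pass through any one of the three
strings of a fork and exclude the other two, so a function that returns only two of them is
defeated.

Strictness follows from the first non-inclusion and monotonicity in `b`. The rest of the file shows
that the three selectors run in polynomial time: they filter the input by predicates built from
finite automata on pairs of strings, Boolean operations and counting quantifiers with constant
threshold. -/

namespace MultiSel

/-! ### Machine fragments, their composition and their running times -/

/-- Contents of a family of stacks of bits. -/
abbrev Store (R : Type) : Type := R → List Bool

/-- Elementary instructions of a stack machine with registers `R` and jump targets `X`. -/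
inductive Instr (R X : Type)
  | jump (x : X)
  | push (r : R) (b : Bool) (x : X)
  | pop (r : R) (g : Option Bool → X)

namespace Instr

variable {R X Y : Type}

def map (f : X → Y) : Instr R X → Instr R Y
  | jump x => jump (f x)
  | push r b x => push r b (f x)
  | pop r g => pop r (f ∘ g)

variable [DecidableEq R]

def exec : Instr R X → Store R → X × Store R
  | jump x, s => (x, s)
  | push r b x, s => (x, Function.update s r (b :: s r))
  | pop r g, s => (g (s r).head?, Function.update s r (s r).tail)

theorem exec_map (f : X → Y) (I : Instr R X) (s : Store R) :
    (I.map f).exec s = (f (I.exec s).1, (I.exec s).2) := by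
  cases I <;> rfl

end Instr

/-- A machine fragment: finitely many labels, each carrying an instruction, an entry point, and
exits that return a value of type `E`. -/
structure Frag (R E : Type) where
  Λ : Type
  [fin : Finite Λ]
  entry : Λ ⊕ E
  code : Λ → Instr R (Λ ⊕ E)

attribute [instance] Frag.fin

namespace Frag

variable {R E E' Q : Type} [DecidableEq R]

def step (F : Frag R E) : (F.Λ ⊕ E) × Store R → (F.Λ ⊕ E) × Store R
  | (Sum.inl l, s) => (F.code l).exec s
  | (Sum.inr e, s) => (Sum.inr e, s)

/-- Started with store `s`, the fragment returns `e` with store `s'` within `t` steps. -/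
def Run (F : Frag R E) (s : Store R) (t : ℕ) (e : E) (s' : Store R) : Prop :=
  F.step^[t] (F.entry, s) = (Sum.inr e, s')

theorem step_iterate_exit (F : Frag R E) (e : E) (s : Store R) (n : ℕ) :
    F.step^[n] (Sum.inr e, s) = (Sum.inr e, s) :=
  Function.iterate_fixed rfl n

theorem iterate_mono {F : Frag R E} {x : (F.Λ ⊕ E) × Store R} {e : E} {s' : Store R} {n t : ℕ}
    (h : F.step^[n] x = (Sum.inr e, s')) (hn : n ≤ t) : F.step^[t] x = (Sum.inr e, s') := by
  obtain ⟨k, rfl⟩ := Nat.exists_eq_add_of_le' hn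
  rw [Function.iterate_add_apply, h, step_iterate_exit]

theorem Run.mono {F : Frag R E} {s s' : Store R} {e : E} {t t' : ℕ} (h : F.Run s t e s')
    (ht : t ≤ t') : F.Run s t' e s' :=
  iterate_mono h ht

theorem Run.cast {F : Frag R E} {s s' s'' : Store R} {e : E} {t t' : ℕ} (h : F.Run s t e s')
    (ht : t ≤ t') (hs : s' = s'') : F.Run s t' e s'' :=
  hs ▸ h.mono ht

/-- A fragment embedded in another one is simulated step by step until it exits. -/
theorem iterate_embed {F : Frag R E} {G : Frag R E'} (i : F.Λ ⊕ E → G.Λ ⊕ E')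
    (hi : ∀ l, ∃ l', i (Sum.inl l) = Sum.inl l' ∧ G.code l' = (F.code l).map i)
    {e : E} {s' : Store R} (t : ℕ) (x : F.Λ ⊕ E) (s : Store R)
    (h : F.step^[t] (x, s) = (Sum.inr e, s')) :
    ∃ n ≤ t, G.step^[n] (i x, s) = (i (Sum.inr e), s') := by
  induction t generalizing x s with
  | zero => exact ⟨0, le_rfl, by cases h; rfl⟩
  | succ t ih =>
    rcases x with l | e₀
    · obtain ⟨l', h1, h2⟩ := hi l
      rw [Function.iterate_succ_apply] at h
      obtain ⟨n, hn, h3⟩ := ih _ _ h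
      refine ⟨n + 1, by omega, ?_⟩
      rw [Function.iterate_succ_apply, h1]
      change G.step^[n] ((G.code l').exec s) = _
      rw [h2, Instr.exec_map]
      exact h3
    · rw [step_iterate_exit] at h
      cases h
      exact ⟨0, Nat.zero_le _, rfl⟩

def pure (e : E) : Frag R E where
  Λ := Empty
  entry := Sum.inr e
  code := Empty.elim

def push (r : R) (b : Bool) : Frag R Unit where
  Λ := Unit
  entry := Sum.inl ()
  code _ := Instr.push r b (Sum.inr ())

def pop (r : R) : Frag R (Option Bool) where
  Λ := Unit
  entry := Sum.inl ()
  code _ := Instr.pop r Sum.inr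

/-- The position in `F.bind G` of a position of `G e`. -/
def bindRight (F : Frag R E) (G : E → Frag R E') (e : E) :
    (G e).Λ ⊕ E' → (F.Λ ⊕ (Σ e, (G e).Λ)) ⊕ E' :=
  Sum.map (fun l => Sum.inr ⟨e, l⟩) id

/-- The position in `F.bind G` of a position of `F`. -/
def bindLeft (F : Frag R E) (G : E → Frag R E') :
    F.Λ ⊕ E → (F.Λ ⊕ (Σ e, (G e).Λ)) ⊕ E' :=
  Sum.elim (fun l => Sum.inl (Sum.inl l)) (fun e => bindRight F G e (G e).entry)

def bind [Finite E] (F : Frag R E) (G : E → Frag R E') : Frag R E' where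
  Λ := F.Λ ⊕ (Σ e, (G e).Λ)
  entry := bindLeft F G F.entry
  code := Sum.elim (fun l => (F.code l).map (bindLeft F G))
    (fun p => ((G p.1).code p.2).map (bindRight F G p.1))

/-- The position in an iteration of a position of its body. -/
def iterBody (body : Q → Frag R (Q ⊕ E)) (q : Q) :
    (body q).Λ ⊕ (Q ⊕ E) → (Q ⊕ (Σ q, (body q).Λ)) ⊕ E :=
  Sum.elim (fun l => Sum.inl (Sum.inr ⟨q, l⟩)) (Sum.map Sum.inl id)

/-- Iterate the body from the control state `q` until it exits with a result. -/
def iter [Finite Q] (body : Q → Frag R (Q ⊕ E)) (q : Q) : Frag R E where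
  Λ := Q ⊕ (Σ q, (body q).Λ)
  entry := Sum.inl (Sum.inl q)
  -- A body may exit without executing an instruction, so each control state needs a label of its
  -- own to which the loop can return. The jump costs one step per round.
  code := Sum.elim (fun q => Instr.jump (iterBody body q (body q).entry))
    (fun p => ((body p.1).code p.2).map (iterBody body p.1))

theorem run_pure (e : E) (s : Store R) : (pure e : Frag R E).Run s 0 e s := rfl

theorem run_push (r : R) (b : Bool) (s : Store R) :
    (push r b).Run s 1 () (Function.update s r (b :: s r)) := rfl

theorem run_pop (r : R) (s : Store R) :
    (pop r).Run s 1 (s r).head? (Function.update s r (s r).tail) := rfl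

/-- The exit `e` of `F` is identified with the entry of `G e`, so the hand-over is free and the time
bounds simply add. -/
theorem Run.bind [Finite E] {F : Frag R E} {G : E → Frag R E'} {s s₁ s₂ : Store R} {e : E} {e' : E'}
    {t t' : ℕ} (h : F.Run s t e s₁) (h' : (G e).Run s₁ t' e' s₂) :
    (F.bind G).Run s (t + t') e' s₂ := by
  obtain ⟨n, hn, h1⟩ := iterate_embed (G := F.bind G) (bindLeft F G)
    (fun l => ⟨Sum.inl l, rfl, rfl⟩) t F.entry s h
  obtain ⟨m, hm, h2⟩ := iterate_embed (G := F.bind G) (bindRight F G e)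
    (fun l => ⟨Sum.inr ⟨e, l⟩, rfl, rfl⟩) t' (G e).entry s₁ h'
  refine iterate_mono (n := m + n) ?_ (by omega)
  rw [Function.iterate_add_apply]
  exact (congrArg _ h1).trans h2

theorem Run.map [Finite E] {F : Frag R E} {s s' : Store R} {e : E} {t : ℕ} (g : E → E')
    (h : F.Run s t e s') : (F.bind fun e => pure (g e)).Run s t (g e) s' :=
  h.bind (t' := 0) rfl

theorem Run.iter_aux [Finite Q] {body : Q → Frag R (Q ⊕ E)} {q : Q} {s s₁ : Store R} {t : ℕ}
    {x : Q ⊕ E} (h : (body q).Run s t x s₁) :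
    ∃ n ≤ t + 1, (iter body q).step^[n] ((iter body q).entry, s) =
      (Sum.map Sum.inl id x, s₁) := by
  obtain ⟨n, hn, h1⟩ := iterate_embed (G := iter body q) (iterBody body q)
    (fun l => ⟨Sum.inr ⟨q, l⟩, rfl, rfl⟩) t (body q).entry s h
  refine ⟨n + 1, by omega, ?_⟩
  rw [Function.iterate_succ_apply]
  exact h1

theorem Run.iter_exit [Finite Q] {body : Q → Frag R (Q ⊕ E)} {q : Q} {s s₁ : Store R} {t : ℕ}
    {e : E} (h : (body q).Run s t (Sum.inr e) s₁) : (iter body q).Run s (t + 1) e s₁ := by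
  obtain ⟨n, hn, h1⟩ := Run.iter_aux h
  exact iterate_mono h1 hn

/-- The initial control state affects the entry point only. Hence a run from `q'` can be appended to
a round that started in `q`. -/
theorem iter_step [Finite Q] (body : Q → Frag R (Q ⊕ E)) (q q' : Q) :
    (iter body q).step = (iter body q').step := by
  funext ⟨x, s⟩
  rcases x with l | e <;> rfl

theorem Run.iter_next [Finite Q] {body : Q → Frag R (Q ⊕ E)} {q q' : Q} {s s₁ s₂ : Store R}
    {t t' : ℕ} {e : E} (h : (body q).Run s t (Sum.inl q') s₁)
    (h' : (iter body q').Run s₁ t' e s₂) : (iter body q).Run s (t + 1 + t') e s₂ := by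
  obtain ⟨n, hn, h1⟩ := Run.iter_aux h
  refine iterate_mono (n := t' + n) ?_ (by omega)
  rw [Function.iterate_add_apply]
  refine (congrArg _ h1).trans ?_
  rw [iter_step body q q']
  exact h'

attribute [irreducible] Run pure push pop bind iter

end Frag

end MultiSel

/-! ### Basic fragments: moving, copying, erasing and parsing stacks -/

namespace MultiSel

namespace Frag

open Function

variable {R : Type} [DecidableEq R]

/-- Pop the symbols of `a` one by one and push them on `b`. -/
def move (a b : R) : Frag R Unit :=
  iter (fun _ : Unit => (pop a).bind fun o => match o with
    | none => pure (Sum.inr ())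
    | some x => (push b x).bind fun _ => pure (Sum.inl ())) ()

/-- Pop the symbols of `a` one by one and push each on both `b` and `c`. -/
def moveBoth (a b c : R) : Frag R Unit :=
  iter (fun _ : Unit => (pop a).bind fun o => match o with
    | none => pure (Sum.inr ())
    | some x => (push b x).bind fun _ => (push c x).bind fun _ => pure (Sum.inl ())) ()

def clear (a : R) : Frag R Unit :=
  iter (fun _ : Unit => (pop a).bind fun o => match o with
    | none => pure (Sum.inr ())
    | some _ => pure (Sum.inl ())) ()

def pushAll (a : R) : List Bool → Frag R Unit
  | [] => pure ()
  | b :: l => (push a b).bind fun _ => pushAll a l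

/-- Pop the code of one string from `a` and push its bits on `b`; the result tells whether there
was a string. -/
def nextStr (a b : R) : Frag R Bool :=
  iter (fun _ : Unit => (pop a).bind fun o => match o with
    | none => pure (Sum.inr false)
    | some false => pure (Sum.inr true)
    | some true => (pop a).bind fun o => match o with
      | none => pure (Sum.inr false)
      | some x => (push b x).bind fun _ => pure (Sum.inl ())) ()

theorem run_move {a b : R} (hab : a ≠ b) (l : List Bool) (s : Store R) (hl : s a = l) :
    (move a b).Run s (3 * l.length + 3) () (update (update s a []) b (l.reverse ++ s b)) := by
  induction l generalizing s with
  | nil =>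
    refine Run.cast (Run.iter_exit (Run.bind (run_pop a s) (e' := Sum.inr ()) (s₂ := s) (t' := 0) ?_))
      (by simp) (by rw [show update s a [] = s by simp [← hl]]; simp)
    rw [hl]
    simp only [List.head?_nil, List.tail_nil]
    rw [show update s a [] = s by simp [← hl]]
    exact run_pure _ _
  | cons x l ih =>
    refine Run.cast (Run.iter_next (t := 2) (Run.bind (t := 1) (t' := 1) (run_pop a s)
      (s₂ := update (update s a l) b (x :: s b)) ?_) (ih _ (by simp [hab]))) (by simp; omega) ?_
    · rw [hl]
      refine Run.cast (Run.bind (run_push b x _) (run_pure _ _)) le_rfl ?_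
      simp [hab.symm]
    · funext r
      by_cases h1 : r = a <;> by_cases h2 : r = b <;> simp_all

theorem run_clear (a : R) (l : List Bool) (s : Store R) (hl : s a = l) :
    (clear a).Run s (2 * l.length + 2) () (update s a []) := by
  induction l generalizing s with
  | nil =>
    refine Run.cast (Run.iter_exit (Run.bind (run_pop a s) (e' := Sum.inr ())
      (s₂ := update s a []) (t' := 0) ?_)) (by simp) rfl
    rw [hl]
    exact run_pure _ _
  | cons x l ih =>
    refine Run.cast (Run.iter_next (t := 1) (Run.bind (t := 1) (t' := 0) (run_pop a s)
      (s₂ := update s a l) ?_) (ih _ (by simp))) (by simp; omega) (by simp)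
    rw [hl]
    exact run_pure _ _

theorem run_moveBoth {a b c : R} (hab : a ≠ b) (hac : a ≠ c) (hbc : b ≠ c) (l : List Bool)
    (s : Store R) (hl : s a = l) :
    (moveBoth a b c).Run s (4 * l.length + 3) ()
      (update (update (update s a []) b (l.reverse ++ s b)) c (l.reverse ++ s c)) := by
  induction l generalizing s with
  | nil =>
    refine Run.cast (Run.iter_exit (Run.bind (run_pop a s) (e' := Sum.inr ()) (s₂ := s) (t' := 0) ?_))
      (by simp) (by rw [show update s a [] = s by simp [← hl]]; simp)
    rw [hl]
    simp only [List.head?_nil, List.tail_nil]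
    rw [show update s a [] = s by simp [← hl]]
    exact run_pure _ _
  | cons x l ih =>
    refine Run.cast (Run.iter_next (t := 3) (Run.bind (t := 1) (t' := 2) (run_pop a s)
      (s₂ := update (update (update s a l) b (x :: s b)) c (x :: s c)) ?_)
      (ih _ (by simp [hab, hac]))) (by simp; omega) ?_
    · rw [hl]
      refine Run.cast (Run.bind (run_push b x _) (Run.bind (run_push c x _) (run_pure _ _)))
        le_rfl ?_
      simp [hab.symm, hac.symm, hbc.symm]
    · funext r
      by_cases h1 : r = a <;> by_cases h2 : r = b <;> by_cases h3 : r = c <;> simp_all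

theorem run_pushAll (a : R) (l : List Bool) (s : Store R) :
    (pushAll a l).Run s l.length () (update s a (l.reverse ++ s a)) := by
  induction l generalizing s with
  | nil => exact (run_pure () s).cast (by simp) (by simp)
  | cons x l ih =>
    exact ((run_push a x s).bind (ih _)).cast (by simp; omega) (by simp)

theorem run_nextStr_nil (a b : R) (s : Store R) (hl : s a = []) :
    (nextStr a b).Run s 2 false s := by
  refine Run.cast (Run.iter_exit (Run.bind (run_pop a s) (e' := Sum.inr false) (s₂ := s)
    (t' := 0) ?_)) (by simp) rfl
  rw [hl]
  simp only [List.head?_nil, List.tail_nil]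
  rw [show update s a [] = s by simp [← hl]]
  exact run_pure _ _

theorem encodeStr_nil : encodeStr [] = [false] := rfl

theorem encodeStr_cons (b : Bool) (x : Str) : encodeStr (b :: x) = true :: b :: encodeStr x := rfl

theorem length_encodeStr (x : Str) : (encodeStr x).length = 2 * x.length + 1 := by
  induction x with
  | nil => rfl
  | cons b x ih => simp [encodeStr_cons, ih]; omega

theorem run_nextStr {a b : R} (hab : a ≠ b) (x : Str) (l : List Bool) (s : Store R)
    (hl : s a = encodeStr x ++ l) :
    (nextStr a b).Run s (4 * x.length + 2) true (update (update s a l) b (x.reverse ++ s b)) := by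
  induction x generalizing s with
  | nil =>
    refine Run.cast (Run.iter_exit (Run.bind (run_pop a s) (e' := Sum.inr true)
      (s₂ := update s a l) (t' := 0) ?_)) (by simp) (by simp [hab.symm])
    rw [hl]
    exact run_pure _ _
  | cons x y ih =>
    refine Run.cast (Run.iter_next (t := 3) (Run.bind (t := 1) (t' := 2) (run_pop a s)
      (s₂ := update (update s a (encodeStr y ++ l)) b (x :: s b)) ?_) (ih _ (by simp [hab])))
      (by simp; omega) ?_
    · rw [hl, encodeStr_cons]
      refine (Run.bind (t := 1) (t' := 1) (run_pop a _)
        (s₂ := update (update s a (encodeStr y ++ l)) b (x :: s b)) ?_)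
      simp only [List.cons_append, List.tail_cons, update_self, List.head?_cons, update_idem]
      refine Run.cast (Run.bind (run_push b x _) (run_pure _ _)) le_rfl ?_
      simp [hab.symm]
    · funext r
      by_cases h1 : r = a <;> by_cases h2 : r = b <;> simp_all

end Frag

end MultiSel

/-! ### Registers, and finite automata reading two strings in parallel -/

namespace MultiSel

open Function Polynomial

/-- Registers of the programs below: two lists of strings, two auxiliary stacks, an output stack,
and for each of `N` variables its value and a cursor into one of the lists. -/
inductive Reg (N : ℕ)
  | lst (b : Bool)
  | tmp (b : Bool)
  | out
  | var (i : Fin N)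
  | cur (i : Fin N)
  deriving DecidableEq

instance (N : ℕ) : Finite (Reg N) := by
  let f : Reg N → Bool ⊕ Bool ⊕ Unit ⊕ Fin N ⊕ Fin N
    | .lst b => .inl b
    | .tmp b => .inr (.inl b)
    | .out => .inr (.inr (.inl ()))
    | .var i => .inr (.inr (.inr (.inl i)))
    | .cur i => .inr (.inr (.inr (.inr i)))
  refine Finite.of_injective f fun a b h => ?_
  cases a <;> cases b <;> simp_all [f]

/-- Final state of a finite automaton that reads two strings in parallel, the shorter one being
padded with `none`. -/
def pairRun {Q : Type} (δ : Q → Option Bool → Option Bool → Q) :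
    Q → List Bool → List Bool → Q
  | q, [], [] => q
  | q, a :: x, [] => pairRun δ (δ q (some a) none) x []
  | q, [], b :: y => pairRun δ (δ q none (some b)) [] y
  | q, a :: x, b :: y => pairRun δ (δ q (some a) (some b)) x y

theorem pairRun_absorb {Q : Type} {δ : Q → Option Bool → Option Bool → Q} {q : Q}
    (h : ∀ a b, δ q a b = q) (x y : List Bool) : pairRun δ q x y = q := by
  induction x generalizing y with
  | nil =>
    induction y with
    | nil => rw [pairRun]
    | cons b y ih => rw [pairRun, h, ih]
  | cons a x ih =>
    cases y with
    | nil => rw [pairRun, h, ih]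
    | cons b y => rw [pairRun, h, ih]

/-- Replace the last bit of a string by `11`. -/
def alt (x : Str) : Str := x.dropLast ++ [true, true]

def altIf (tr : Bool) (x : Str) : Str := if tr then alt x else x

namespace Frag

variable {R Q : Type} [DecidableEq R]

def pushOpt (a : R) : Option Bool → Frag R Unit
  | none => pure ()
  | some b => push a b

theorem run_pushOpt (a : R) (o : Option Bool) (s : Store R) :
    (pushOpt a o).Run s 1 () (update s a (o.toList ++ s a)) := by
  cases o with
  | none => exact (run_pure () s).cast (by simp) (by simp)
  | some b => exact run_push a b s

/-- Run the automaton `δ` on the strings in `a` and `b`, which are moved to `c` and `d`. -/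
def pairLoop [Finite Q] (δ : Q → Option Bool → Option Bool → Q) (a b c d : R) (q : Q) : Frag R Q :=
  iter (fun q => (pop a).bind fun o₁ => (pushOpt c o₁).bind fun _ => (pop b).bind fun o₂ =>
    (pushOpt d o₂).bind fun _ => pure (if o₁ = none ∧ o₂ = none then Sum.inr q
      else Sum.inl (δ q o₁ o₂))) q

theorem run_pairBody [Finite Q] (δ : Q → Option Bool → Option Bool → Q) {a b c d : R}
    (hab : a ≠ b) (hac : a ≠ c) (had : a ≠ d) (hbc : b ≠ c) (hbd : b ≠ d) (hcd : c ≠ d) (q : Q)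
    (s : Store R) (x y : List Bool) (hx : s a = x) (hy : s b = y) :
    Run ((pop a).bind fun o₁ => (pushOpt c o₁).bind fun _ => (pop b).bind fun o₂ =>
      (pushOpt d o₂).bind fun _ => pure (if o₁ = none ∧ o₂ = none then (Sum.inr q : Q ⊕ Q)
        else Sum.inl (δ q o₁ o₂))) s 4
      (if x.head? = none ∧ y.head? = none then Sum.inr q else Sum.inl (δ q x.head? y.head?))
      (update (update (update (update s a x.tail) b y.tail) c (x.head?.toList ++ s c)) d
        (y.head?.toList ++ s d)) := by
  subst hx
  refine Run.bind (t := 1) (t' := 3) (run_pop a s) ?_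
  refine Run.bind (t := 1) (t' := 2) (run_pushOpt c _ _) ?_
  have hb : (update (update s a (s a).tail) c
    ((s a).head?.toList ++ update s a (s a).tail c)) b = y := by simp [hab.symm, hbc, hy]
  have h := run_pop b (update (update s a (s a).tail) c
    ((s a).head?.toList ++ update s a (s a).tail c))
  rw [hb] at h
  refine Run.bind (t := 1) (t' := 1) h ?_
  refine Run.bind (t := 1) (t' := 0) (run_pushOpt d _ _) ?_
  refine (run_pure _ _).cast le_rfl ?_
  funext r
  by_cases h1 : r = a <;> by_cases h2 : r = b <;> by_cases h3 : r = c <;> by_cases h4 : r = d <;>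
    simp_all

/-- A round takes four elementary steps and a jump, and there are at most `|x| + |y| + 1` rounds.
The strings end up reversed in `c` and `d`, so that `move` can restore them. -/
theorem run_pairLoop [Finite Q] (δ : Q → Option Bool → Option Bool → Q) {a b c d : R}
    (hab : a ≠ b) (hac : a ≠ c) (had : a ≠ d) (hbc : b ≠ c) (hbd : b ≠ d) (hcd : c ≠ d) (q : Q)
    (s : Store R) (x y : List Bool) (hx : s a = x) (hy : s b = y) :
    (pairLoop δ a b c d q).Run s (5 * (x.length + y.length) + 5) (pairRun δ q x y)
      (update (update (update (update s a []) b []) c (x.reverse ++ s c)) d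
        (y.reverse ++ s d)) := by
  induction q, x, y using pairRun.induct δ generalizing s with
  | case1 q =>
    rw [pairRun]
    have key := run_pairBody δ hab hac had hbc hbd hcd q s _ _ hx hy
    rw [if_pos (by simp)] at key
    exact (Run.iter_exit key).cast (by simp) (by simp)
  | case2 q e x ih =>
    rw [pairRun]
    have key := run_pairBody δ hab hac had hbc hbd hcd q s _ _ hx hy
    rw [if_neg (by simp)] at key
    refine (Run.iter_next key (ih _ ?_ ?_)).cast (by simp only [List.length_cons]; omega) ?_
    any_goals simp [hab, hac, had, hbc, hbd]
    funext r
    by_cases h1 : r = a <;> by_cases h2 : r = b <;> by_cases h3 : r = c <;>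
      by_cases h4 : r = d <;> simp_all
  | case3 q e y ih =>
    rw [pairRun]
    have key := run_pairBody δ hab hac had hbc hbd hcd q s _ _ hx hy
    rw [if_neg (by simp)] at key
    refine (Run.iter_next key (ih _ ?_ ?_)).cast (by simp only [List.length_cons]; omega) ?_
    any_goals simp [hab, hac, had, hbc, hbd]
    funext r
    by_cases h1 : r = a <;> by_cases h2 : r = b <;> by_cases h3 : r = c <;>
      by_cases h4 : r = d <;> simp_all
  | case4 q e x f y ih =>
    rw [pairRun]
    have key := run_pairBody δ hab hac had hbc hbd hcd q s _ _ hx hy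
    rw [if_neg (by simp)] at key
    refine (Run.iter_next key (ih _ ?_ ?_)).cast (by simp only [List.length_cons]; omega) ?_
    any_goals simp [hab, hac, had, hbc, hbd]
    funext r
    by_cases h1 : r = a <;> by_cases h2 : r = b <;> by_cases h3 : r = c <;>
      by_cases h4 : r = d <;> simp_all

end Frag

end MultiSel

/-! ### Loops over the strings of a list -/

namespace MultiSel

open Function Polynomial

variable {N : ℕ}

namespace Frag

variable {Q : Type}

/-- Move the string in the first auxiliary stack, which holds it reversed, to the variable `i`,
replacing the last bit by `11` if `tr` holds. -/
def loadStr (tr : Bool) (i : Fin N) : Frag (Reg N) Unit :=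
  match tr with
  | false => move (.tmp false) (.var i)
  | true => (pop (.tmp false)).bind fun _ => (push (.tmp false) true).bind fun _ =>
      (push (.tmp false) true).bind fun _ => move (.tmp false) (.var i)

theorem length_altIf_le (tr : Bool) (x : Str) : (altIf tr x).length ≤ x.length + 2 := by
  cases tr <;> simp [altIf, alt]

theorem run_loadStr (tr : Bool) (i : Fin N) (x : Str) (s : Store (Reg N))
    (hx : s (.tmp false) = x.reverse) (hi : s (.var i) = []) :
    (loadStr tr i).Run s (3 * x.length + 12) ()
      (update (update s (.tmp false) []) (.var i) (altIf tr x)) := by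
  cases tr with
  | false =>
    exact (run_move (by simp) _ s hx).cast (by simp) (by simp [hi, altIf])
  | true =>
    have h := run_move (a := Reg.tmp false) (b := Reg.var i) (by simp) (true :: true :: x.reverse.tail)
      (update s (.tmp false) (true :: true :: x.reverse.tail)) (by simp)
    refine Run.cast (Run.bind (t := 1) (t' := 3 * x.length + 11) (run_pop _ s) (Run.cast
      (Run.bind (t := 1) (t' := 3 * x.length + 10) (run_push _ _ _) (Run.cast
      (Run.bind (t := 1) (t' := 3 * x.length + 9) (run_push _ _ _) ?_)
      (by omega) rfl)) (by omega) rfl)) (by omega) rfl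
    have e : update s (.tmp false) (true :: true :: x.reverse.tail) =
        update (update (update s (.tmp false) (s (.tmp false)).tail) (.tmp false)
          (true :: update s (.tmp false) (s (.tmp false)).tail (.tmp false))) (.tmp false)
          (true :: (update (update s (.tmp false) (s (.tmp false)).tail) (.tmp false)
          (true :: update s (.tmp false) (s (.tmp false)).tail (.tmp false))) (.tmp false)) := by
      simp [hx]
    rw [← e]
    exact h.cast (by simp; omega) (by simp [hi, altIf, alt])

/-- One round of the loop over a list of strings: fetch the next string, run the body, and erase
the variable. -/
def forBody [Finite Q] (tr : Bool) (i : Fin N) (body : Q → Frag (Reg N) Q) (q : Q) :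
    Frag (Reg N) (Q ⊕ Q) :=
  (nextStr (.cur i) (.tmp false)).bind fun b => match b with
    | false => pure (Sum.inr q)
    | true => (loadStr tr i).bind fun _ => (body q).bind fun q' => (clear (.var i)).bind fun _ =>
        pure (Sum.inl q')

/-- Run the body for each string of the list in `lst b`, with the string in the variable `i`. -/
def forEach [Finite Q] (b tr : Bool) (i : Fin N) (body : Q → Frag (Reg N) Q) (q : Q) :
    Frag (Reg N) Q :=
  (move (.lst b) (.tmp false)).bind fun _ => (moveBoth (.tmp false) (.lst b) (.cur i)).bind fun _ =>
    iter (forBody tr i body) q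

/-- Here `ψ` is the effect of the body on the control state and `φ` is what it pushes on `out`.
Those two and the cursor are all that changes from round to round, so the body is assumed correct
for every store that agrees with the initial one outside `out` and the cursor and has the current
string in the variable. -/
theorem run_forLoop [Finite Q] (tr : Bool) (i : Fin N) (body : Q → Frag (Reg N) Q) (n T : ℕ)
    (ψ : Q → Str → Q) (φ : Str → List Bool) (L : List Str) (hL : ∀ x ∈ L, x.length ≤ n)
    (s : Store (Reg N)) (hcur : s (.cur i) = L.flatMap encodeStr) (htmp : s (.tmp false) = [])
    (hvar : s (.var i) = [])
    (hbody : ∀ x ∈ L, ∀ q, ∀ s' : Store (Reg N),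
      (∀ r, r ≠ .out → r ≠ .cur i → s' r = update s (.var i) (altIf tr x) r) →
      (s' (.cur i)).length ≤ (s (.cur i)).length →
      (body q).Run s' T (ψ q x) (update s' .out (φ x ++ s' .out))) (q : Q) :
    (iter (forBody tr i body) q).Run s ((L.length + 1) * (9 * n + T + 21)) (L.foldl ψ q)
      (update (update s (.cur i) []) .out (L.foldl (fun o x => φ x ++ o) (s .out))) := by
  induction L generalizing s q with
  | nil =>
    refine (Run.iter_exit (t := 2) ?_).cast (by simp) rfl
    refine Run.cast (Run.bind (t := 2) (t' := 0) (e' := Sum.inr q)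
      (run_nextStr_nil _ _ s (by simpa using hcur)) (run_pure (Sum.inr q) s)) le_rfl ?_
    have : update s (.cur i) [] = s := by
      rw [← show s (.cur i) = [] by simpa using hcur, update_eq_self]
    simp [this]
  | cons x L ih =>
    have hx : x.length ≤ n := hL x (by simp)
    have hax := length_altIf_le tr x
    set s₁ := update (update (update s (.cur i) (L.flatMap encodeStr)) (.tmp false) [])
      (.var i) (altIf tr x) with hs₁
    set s₂ := update (update s (.cur i) (L.flatMap encodeStr)) .out (φ x ++ s .out) with hs₂
    have e1 := run_nextStr (a := Reg.cur i) (b := .tmp false) (by simp) x (L.flatMap encodeStr) s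
      (by simpa using hcur)
    have e2 := run_loadStr tr i x _ (show (update (update s (.cur i) (L.flatMap encodeStr))
      (.tmp false) (x.reverse ++ s (.tmp false))) (.tmp false) = x.reverse by simp [htmp])
      (by simp [hvar])
    have e3 := hbody x (by simp) q s₁ (by
      intro r h1 h2
      by_cases h3 : r = .var i
      · simp [hs₁, h3]
      · by_cases h4 : r = .tmp false <;> simp [hs₁, h2, h3, h4, htmp]) (by
      simp [hs₁, hcur])
    have e4 := run_clear (.var i) (altIf tr x) (update s₁ .out (φ x ++ s₁ .out)) (by simp [hs₁])
    -- Fetching costs `4n + 2`, loading `3n + 12`, the body `T`, and erasing a string of length at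
    -- most `n + 2` costs `2n + 6`.
    have e : (forBody tr i body q).Run s (9 * n + T + 20) (Sum.inl (ψ q x)) s₂ := by
      refine Run.cast (Run.bind (e1.mono (t' := 4 * n + 2) (by omega)) (Run.bind
        (e2.cast (t' := 3 * n + 12) (s'' := s₁) (by omega) ?_) (Run.bind e3 (Run.bind
        (t' := 0) (e4.mono (t' := 2 * n + 6) (by omega)) (run_pure _ _))))) (by omega) ?_
      · rw [hs₁]; simp
      · rw [hs₂, hs₁]
        funext r
        rcases r with b | b | _ | j | j
        · simp
        · by_cases h : b = false <;> simp [h, htmp]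
        · simp
        · by_cases h : j = i <;> simp [h, hvar]
        · by_cases h : j = i <;> simp [h]
    refine (Run.iter_next e (ih (fun y hy => hL y (by simp [hy])) s₂ ?_ ?_ ?_ ?_ (ψ q x))).cast
      ?_ ?_
    · simp [hs₂]
    · simp [hs₂, htmp]
    · simp [hs₂, hvar]
    · intro y hy q' s' h1 h2
      refine hbody y (by simp [hy]) q' s' ?_ (h2.trans (by simp [hs₂, hcur]))
      intro r hr hr'
      rw [h1 r hr hr']
      by_cases h3 : r = .var i <;> simp [h3, hs₂, hr, hr']
    · simp only [List.length_cons]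
      linarith
    · simp only [hs₂, List.foldl_cons]
      funext r
      rcases r with b | b | _ | j | j
      · simp
      · simp
      · simp
      · simp
      · by_cases h : j = i <;> simp [h]

theorem length_le_of_mem_flatMap {L : List Str} {x : Str} (hx : x ∈ L) :
    x.length < (L.flatMap encodeStr).length := by
  have := (List.sublist_flatten_of_mem (List.mem_map_of_mem (f := encodeStr) hx)).length_le
  rw [← List.flatMap_def, length_encodeStr] at this
  omega

theorem length_le_flatMap (L : List Str) : L.length ≤ (L.flatMap encodeStr).length := by
  induction L with
  | nil => simp
  | cons x L ih =>
    simp only [List.flatMap_cons, List.length_cons, List.length_append, length_encodeStr]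
    omega

/-- The list is reversed into an auxiliary stack and reversed back into both its own register and
the cursor; only the cursor is consumed, so loops over the same list can be nested. The copying
costs `7n + 6`, which turns the constant 21 of `run_forLoop` into 28. -/
theorem run_forEach [Finite Q] (b tr : Bool) (i : Fin N) (body : Q → Frag (Reg N) Q) (n T : ℕ)
    (ψ : Q → Str → Q) (φ : Str → List Bool) (L : List Str)
    (s : Store (Reg N)) (hlst : s (.lst b) = L.flatMap encodeStr)
    (hn : (L.flatMap encodeStr).length ≤ n) (htmp : s (.tmp false) = [])
    (hvar : s (.var i) = []) (hcur : s (.cur i) = [])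
    (hbody : ∀ x ∈ L, ∀ q, ∀ s' : Store (Reg N),
      (∀ r, r ≠ .out → r ≠ .cur i → s' r = update s (.var i) (altIf tr x) r) →
      (s' (.cur i)).length ≤ n →
      (body q).Run s' T (ψ q x) (update s' .out (φ x ++ s' .out))) (q : Q) :
    (forEach b tr i body q).Run s ((n + 1) * (9 * n + T + 28)) (L.foldl ψ q)
      (update s .out (L.foldl (fun o x => φ x ++ o) (s .out))) := by
  set s₁ := update s (.cur i) (L.flatMap encodeStr) with hs₁
  have e1 := run_move (a := Reg.lst b) (b := .tmp false) (by simp) _ s hlst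
  have e2 := run_moveBoth (a := Reg.tmp false) (b := .lst b) (c := .cur i) (by simp) (by simp)
    (by simp) (L.flatMap encodeStr).reverse (update (update s (.lst b) []) (.tmp false)
    ((L.flatMap encodeStr).reverse ++ s (.tmp false))) (by simp [htmp])
  have e3 := run_forLoop tr i body n T ψ φ L
    (fun x hx => ((length_le_of_mem_flatMap hx).trans_le hn).le) s₁ (by simp [hs₁])
    (by simp [hs₁, htmp]) (by simp [hs₁, hvar]) (by
      intro x hx q s' h1 h2
      refine hbody x hx q s' ?_ (h2.trans (by simpa [hs₁] using hn))
      intro r hr hr'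
      rw [h1 r hr hr']
      by_cases h3 : r = .var i <;> simp [h3, hs₁, hr']) q
  refine (Run.bind (e1.mono (t' := 3 * n + 3) (by omega)) (Run.bind
    (e2.cast (t' := 4 * n + 3) (s'' := s₁) (by rw [List.length_reverse]; omega) ?_) e3)).cast ?_ ?_
  · rw [hs₁]
    funext r
    rcases r with b' | b' | _ | j | j
    · by_cases h : b' = b <;> simp [h, hlst]
    · by_cases h : b' = false <;> simp [h, htmp]
    · simp
    · simp
    · by_cases h : j = i <;> simp [h, hcur]
  · have : (L.length + 1) * (9 * n + T + 21) ≤ (n + 1) * (9 * n + T + 21) :=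
      Nat.mul_le_mul_right _ (by have := length_le_flatMap L; omega)
    nlinarith
  · funext r
    rcases r with b' | b' | _ | j | j
    · simp [hs₁]
    · simp [hs₁]
    · simp [hs₁]
    · simp [hs₁]
    · by_cases h : j = i <;> simp [h, hs₁, hcur]

end Frag

end MultiSel

/-! ### A calculus of predicates decidable in polynomial time -/

namespace MultiSel

open Function Polynomial Frag

variable {N : ℕ}

theorem eval_le_eval_of_le (p : ℕ[X]) {m n : ℕ} (h : m ≤ n) : p.eval m ≤ p.eval n := by
  rw [eval_eq_sum, eval_eq_sum]
  exact Finset.sum_le_sum fun i _ => Nat.mul_le_mul_left _ (Nat.pow_le_pow_left h i)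

/-- The lists `ℒ` are stored in `lst`, the auxiliary stacks are empty, and so are the registers of
the variables from `d` on. -/
structure Valid (d : ℕ) (ℒ : Bool → List Str) (s : Store (Reg N)) : Prop where
  lst : ∀ b, s (.lst b) = (ℒ b).flatMap encodeStr
  tmp : ∀ b, s (.tmp b) = []
  var : ∀ i : Fin N, d ≤ i → s (.var i) = []
  cur : ∀ i : Fin N, d ≤ i → s (.cur i) = []

/-- The predicate `P` of two lists of strings and of the values of the first `d` variables is
evaluated in polynomial time by a fragment that leaves the store unchanged. -/
def Ev (d : ℕ) (P : (Bool → List Str) → (Fin N → Str) → Bool) : Prop :=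
  ∃ (F : Frag (Reg N) Bool) (p : ℕ[X]), ∀ ℒ s n, Valid d ℒ s → (∀ r, r ≠ .out → (s r).length ≤ n) →
    F.Run s (p.eval n) (P ℒ fun i => s (.var i)) s

namespace Ev

variable {d : ℕ} {P P' : (Bool → List Str) → (Fin N → Str) → Bool}

/-- The automaton empties the two variables into the auxiliary stacks, and two moves restore them.
The two variables must be distinct because each is consumed as a stack of its own. -/
theorem atom {Q : Type} [Finite Q] (δ : Q → Option Bool → Option Bool → Q) (q : Q) (acc : Q → Bool)
    {i j : Fin N} (hij : i ≠ j) :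
    Ev d fun _ env => acc (pairRun δ q (env i) (env j)) := by
  refine ⟨(pairLoop δ (.var i) (.var j) (.tmp false) (.tmp true) q).bind fun q =>
    (move (.tmp false) (.var i)).bind fun _ => (move (.tmp true) (.var j)).bind fun _ =>
      pure (acc q), 16 * X + 11, fun ℒ s n hs hn => ?_⟩
  have hij' : Reg.var i ≠ Reg.var j := by simpa using hij
  have e1 := run_pairLoop δ (a := Reg.var i) (b := .var j) (c := .tmp false) (d := .tmp true)
    hij' (by simp) (by simp) (by simp) (by simp) (by simp) q s _ _ rfl rfl
  set s₁ := update (update (update (update s (.var i) []) (.var j) []) (.tmp false)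
    (s (.var i)).reverse) (.tmp true) (s (.var j)).reverse with hs₁
  have e2 := run_move (a := Reg.tmp false) (b := Reg.var i) (by simp) (s (.var i)).reverse s₁
    (by simp [hs₁])
  set s₂ := update (update s (.var j) []) (.tmp true) (s (.var j)).reverse with hs₂
  have e3 := run_move (a := Reg.tmp true) (b := Reg.var j) (by simp) (s (.var j)).reverse s₂
    (by simp [hs₂])
  have h1 := hn (.var i) (by simp)
  have h2 := hn (.var j) (by simp)
  simp only [List.length_reverse] at e2 e3
  refine Run.cast (Run.bind (e1.cast (t' := 10 * n + 5) (s'' := s₁) (by omega) ?_) (Run.bind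
    (e2.cast (t' := 3 * n + 3) (s'' := s₂) (by omega) ?_) (Run.map (fun _ => acc _)
    (e3.cast (t' := 3 * n + 3) (s'' := s) (by omega) ?_)))) ?_ rfl
  · simp [hs₁, hs.tmp]
  · funext r
    rcases r with b | b | _ | k | k
    · simp [hs₁, hs₂]
    · cases b <;> simp [hs₁, hs₂, hs.tmp]
    · simp [hs₁, hs₂]
    · by_cases h : k = i <;> by_cases h' : k = j <;> simp_all
    · simp [hs₁, hs₂]
  · funext r
    rcases r with b | b | _ | k | k
    · simp [hs₂]
    · cases b <;> simp [hs₂, hs.tmp]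
    · simp [hs₂]
    · by_cases h' : k = j <;> simp_all
    · simp [hs₂]
  · simp; omega

theorem not (h : Ev d P) : Ev d fun ℒ env => !(P ℒ env) := by
  obtain ⟨F, p, hF⟩ := h
  exact ⟨F.bind fun b => pure (!b), p, fun ℒ s n hs hn => (hF ℒ s n hs hn).map _⟩

theorem binary (op : Bool → Bool → Bool) (h : Ev d P) (h' : Ev d P') :
    Ev d fun ℒ env => op (P ℒ env) (P' ℒ env) := by
  obtain ⟨F, p, hF⟩ := h
  obtain ⟨F', p', hF'⟩ := h'
  exact ⟨F.bind fun b => F'.bind fun b' => pure (op b b'), p + p', fun ℒ s n hs hn =>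
    ((hF ℒ s n hs hn).bind ((hF' ℒ s n hs hn).map (op _))).cast (by simp) rfl⟩

theorem and (h : Ev d P) (h' : Ev d P') : Ev d fun ℒ env => P ℒ env && P' ℒ env :=
  binary _ h h'

theorem or (h : Ev d P) (h' : Ev d P') : Ev d fun ℒ env => P ℒ env || P' ℒ env :=
  binary _ h h'

/-- Variables are numbered by nesting depth: variable `d` is still empty, so it can hold the
constant `z` while `P` is evaluated and be erased afterwards. -/
theorem const (z : Str) (i : Fin N) (hi : (i : ℕ) = d) (h : Ev (d + 1) P) :
    Ev d fun ℒ env => P ℒ (update env i z) := by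
  obtain ⟨F, p, hF⟩ := h
  refine ⟨(pushAll (.var i) z.reverse).bind fun _ => F.bind fun b => (clear (.var i)).bind fun _ =>
    pure b, C z.length + p.comp (X + C z.length) + C (2 * z.length + 2), fun ℒ s n hs hn => ?_⟩
  have hvar := hs.var i hi.ge
  set s₁ := update s (.var i) z with hs₁
  have e2 := hF ℒ s₁ (n + z.length)
    ⟨by simpa [hs₁] using hs.lst, by simpa [hs₁] using hs.tmp, fun j hj => by
      have : j ≠ i := by rintro rfl; omega
      simpa [hs₁, this] using hs.var j (by omega), fun j hj => by
      simpa [hs₁] using hs.cur j (by omega)⟩ (fun r hr => by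
      by_cases h : r = .var i
      · simp [hs₁, h]
      · simpa [hs₁, h] using (hn r hr).trans (by omega))
  have henv : (fun j => s₁ (.var j)) = update (fun j => s (.var j)) i z := by
    funext j
    by_cases h : j = i <;> simp [hs₁, h]
  rw [henv] at e2
  have e1 : (pushAll (.var i) z.reverse).Run s z.length () s₁ :=
    (run_pushAll (.var i) z.reverse s).cast (by simp) (by simp [hvar, hs₁])
  have e3 : (clear (.var i)).Run s₁ (2 * z.length + 2) () s :=
    (run_clear (.var i) z s₁ (by simp [hs₁])).cast le_rfl (by simp [hs₁, ← hvar])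
  have e4 := e1.bind (G := fun _ => F.bind fun b => (clear (.var i)).bind fun _ => pure b)
    (e2.bind (e3.map fun _ => P ℒ (update (fun j => s (.var j)) i z)))
  refine e4.mono ?_
  simp only [eval_add, eval_C, eval_comp, eval_X]
  omega

/-- A counter that saturates at `k` has `k + 1` values and fits into the finite control, which is
why counting quantifiers with a constant threshold need no arithmetic on the stacks. -/
theorem foldl_count (k : ℕ) (p : Str → Bool) (L : List Str) (q : Fin (k + 1)) :
    ((L.foldl (fun (q : Fin (k + 1)) x => if p x then ⟨min (q + 1) k, by omega⟩ else q) q : Fin _) :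
      ℕ) = min (q + L.countP p) k := by
  induction L generalizing q with
  | nil => simp; omega
  | cons x L ih =>
    rw [List.foldl_cons, ih]
    by_cases h : p x <;> simp [h]
    omega

/-- Counting quantifier: at least `k` strings of the list `b` (modified by `alt` if `tr` holds)
satisfy `P`. -/
theorem count (b tr : Bool) (k : ℕ) (i : Fin N) (hi : (i : ℕ) = d) (h : Ev (d + 1) P) :
    Ev d fun ℒ env => decide (k ≤ (ℒ b).countP fun x => P ℒ (update env i (altIf tr x))) := by
  obtain ⟨F, p, hF⟩ := h
  refine ⟨(forEach b tr i (fun q : Fin (k + 1) => F.bind fun c =>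
    pure (if c then ⟨min (q + 1) k, by omega⟩ else q)) 0).bind fun q => pure (decide (q.1 = k)),
    (X + 1) * (9 * X + p.comp (X + 2) + 28), fun ℒ s n hs hn => ?_⟩
  have hlen : ((ℒ b).flatMap encodeStr).length ≤ n := hs.lst b ▸ hn (.lst b) (by simp)
  have e := run_forEach b tr i (fun q : Fin (k + 1) => F.bind fun c =>
    pure (if c then ⟨min (q + 1) k, by omega⟩ else q)) n (p.eval (n + 2))
    (fun q x => if P ℒ (update (fun j => s (.var j)) i (altIf tr x)) then
      ⟨min (q + 1) k, by omega⟩ else q) (fun _ => []) (ℒ b) s (hs.lst b) hlen (hs.tmp _)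
    (hs.var i hi.ge) (hs.cur i hi.ge) (fun x hx q s' h1 h2 => by
      have hx' := length_le_of_mem_flatMap hx
      have hax := length_altIf_le tr x
      have e2 := hF ℒ s' (n + 2) ⟨fun b => by simpa [hs.lst] using h1 (.lst b) (by simp) (by simp),
        fun b => by simpa [hs.tmp] using h1 (.tmp b) (by simp) (by simp), fun j hj => by
          have : j ≠ i := by rintro rfl; omega
          simpa [this, hs.var j (by omega)] using h1 (.var j) (by simp) (by simp), fun j hj => by
          have : j ≠ i := by rintro rfl; omega
          simpa [hs.cur j (by omega)] using h1 (.cur j) (by simp) (by simpa using this)⟩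
        (fun r hr => by
          by_cases h3 : r = .cur i
          · rw [h3]; omega
          · rw [h1 r hr h3]
            by_cases h4 : r = .var i
            · simp only [h4, update_self]; omega
            · simpa [h4] using (hn r hr).trans (by omega))
      have henv : (fun j => s' (.var j)) = update (fun j => s (.var j)) i (altIf tr x) := by
        funext j
        rw [h1 _ (by simp) (by simp)]
        by_cases h : j = i <;> simp [h]
      rw [henv] at e2
      have e3 := e2.map fun c => if c then (⟨min (q + 1) k, by omega⟩ : Fin (k + 1)) else q
      rw [List.nil_append, update_eq_self]
      exact e3) 0
  have hval : (decide (k ≤ (ℒ b).countP fun x => P ℒ (update (fun j => s (.var j)) i (altIf tr x)))) =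
      decide (((ℒ b).foldl (fun (q : Fin (k + 1)) x =>
        if P ℒ (update (fun j => s (.var j)) i (altIf tr x)) then ⟨min (q + 1) k, by omega⟩ else q)
        0 : Fin (k + 1)).1 = k) := by
    rw [foldl_count k fun x => P ℒ (update (fun j => s (.var j)) i (altIf tr x))]
    simp
  simp only [hval]
  refine Run.cast (e.map fun q => decide (q.1 = k)) (by simp) ?_
  simp

end Ev

end MultiSel

/-! ### Writing filtered lists, and the order of the encoding as an automaton -/

namespace MultiSel

open Function Polynomial Frag

variable {N : ℕ}

namespace Frag

/-- Push the code of the string in the variable `i`, reversed, on `out`. -/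
def emit (i : Fin N) : Frag (Reg N) Unit :=
  (iter (fun _ : Unit => (pop (.var i)).bind fun o => match o with
    | none => pure (Sum.inr ())
    | some x => (push (.tmp false) x).bind fun _ => (push .out true).bind fun _ =>
        (push .out x).bind fun _ => pure (Sum.inl ())) ()).bind fun _ =>
  (push .out false).bind fun _ => move (.tmp false) (.var i)

theorem run_emitLoop (i : Fin N) (x : Str) (s : Store (Reg N)) (hx : s (.var i) = x) :
    (iter (fun _ : Unit => (pop (.var i)).bind fun o => match o with
    | none => pure (Sum.inr ())
    | some x => (push (.tmp false) x).bind fun _ => (push .out true).bind fun _ =>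
        (push .out x).bind fun _ => pure (Sum.inl ())) () : Frag (Reg N) Unit).Run s
      (5 * x.length + 2) ()
      (update (update (update s (.var i) []) (.tmp false) (x.reverse ++ s (.tmp false))) .out
        ((x.flatMap fun b => [true, b]).reverse ++ s .out)) := by
  induction x generalizing s with
  | nil =>
    refine Run.cast (Run.iter_exit (Run.bind (run_pop _ s) (e' := Sum.inr ()) (s₂ := s)
      (t' := 0) ?_)) (by simp)
      (by rw [show update s (.var i) [] = s by simp [← hx]]; simp)
    rw [hx]
    simp only [List.head?_nil, List.tail_nil]
    rw [show update s (.var i) [] = s by simp [← hx]]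
    exact run_pure _ _
  | cons b x ih =>
    refine Run.cast (Run.iter_next (t := 4) (Run.bind (t := 1) (t' := 3) (run_pop _ s)
      (s₂ := update (update (update s (.var i) x) (.tmp false) (b :: s (.tmp false))) .out
        (b :: true :: s .out)) ?_) (ih _ (by simp))) (by simp; omega) ?_
    · rw [hx]
      refine Run.cast (Run.bind (run_push _ b _) (Run.bind (run_push _ true _)
        (Run.bind (run_push _ b _) (run_pure _ _)))) le_rfl ?_
      simp
    · funext r
      rcases r with c | c | _ | j | j
      · simp
      · by_cases h : c = false <;> simp [h]
      · simp
      · by_cases h : j = i <;> simp [h]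
      · simp

theorem run_emit (i : Fin N) (s : Store (Reg N)) (htmp : s (.tmp false) = []) :
    (emit i).Run s (8 * (s (.var i)).length + 6) ()
      (update s .out ((encodeStr (s (.var i))).reverse ++ s .out)) := by
  have e1 := run_emitLoop i _ s rfl
  refine Run.cast (Run.bind e1 (Run.bind (run_push _ _ _) (run_move (by simp) _ _ rfl))) ?_ ?_
  · simp [htmp]; omega
  · funext r
    rcases r with c | c | _ | j | j
    · simp
    · by_cases h : c = false <;> simp [h, htmp]
    · simp [encodeStr]
    · by_cases h : j = i <;> simp [h, htmp]
    · simp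

end Frag

/-- Write the code of the sublist of `ℒ b` selected by a predicate, reversed, on `out`. -/
theorem exists_filterTo {d : ℕ} {P : (Bool → List Str) → (Fin N → Str) → Bool} (b : Bool) (i : Fin N)
    (hi : (i : ℕ) = d) (h : Ev (d + 1) P) :
    ∃ (F : Frag (Reg N) Unit) (p : ℕ[X]), ∀ ℒ s n, Valid d ℒ s →
      (∀ r, r ≠ .out → (s r).length ≤ n) → F.Run s (p.eval n) ()
      (update s .out ((((ℒ b).filter fun x =>
        P ℒ (update (fun j => s (.var j)) i x)).flatMap encodeStr).reverse ++ s .out)) := by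
  obtain ⟨F, p, hF⟩ := h
  refine ⟨forEach b false i (fun _ : Unit => F.bind fun c => if c then emit i else pure ()) (),
    (X + 1) * (9 * X + (p.comp (X + 2) + 8 * X + 22) + 28), fun ℒ s n hs hn => ?_⟩
  have hlen : ((ℒ b).flatMap encodeStr).length ≤ n := hs.lst b ▸ hn (.lst b) (by simp)
  have e := run_forEach b false i (fun _ : Unit => F.bind fun c => if c then emit i else pure ()) n
    (p.eval (n + 2) + 8 * n + 22) (fun _ _ => ())
    (fun x => if P ℒ (update (fun j => s (.var j)) i x) then (encodeStr x).reverse else []) (ℒ b) s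
    (hs.lst b) hlen (hs.tmp _) (hs.var i hi.ge) (hs.cur i hi.ge) (fun x hx q s' h1 h2 => by
      simp only [altIf] at h1
      have hx' := length_le_of_mem_flatMap hx
      have e2 := hF ℒ s' (n + 2) ⟨fun b => by simpa [hs.lst] using h1 (.lst b) (by simp) (by simp),
        fun b => by simpa [hs.tmp] using h1 (.tmp b) (by simp) (by simp), fun j hj => by
          have : j ≠ i := by rintro rfl; omega
          simpa [this, hs.var j (by omega)] using h1 (.var j) (by simp) (by simp), fun j hj => by
          have : j ≠ i := by rintro rfl; omega
          simpa [hs.cur j (by omega)] using h1 (.cur j) (by simp) (by simpa using this)⟩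
        (fun r hr => by
          by_cases h3 : r = .cur i
          · rw [h3]; omega
          · rw [h1 r hr h3]
            by_cases h4 : r = .var i
            · simp [h4]; omega
            · simpa [h4] using (hn r hr).trans (by omega))
      have henv : (fun j => s' (.var j)) = update (fun j => s (.var j)) i x := by
        funext j
        rw [h1 _ (by simp) (by simp)]
        by_cases h : j = i <;> simp [h]
      have hvar : s' (.var i) = x := by simpa using h1 (.var i) (by simp) (by simp)
      have htmp : s' (.tmp false) = [] := by
        simpa [hs.tmp] using h1 (.tmp false) (by simp) (by simp)
      rw [henv] at e2
      refine Run.bind (t' := 8 * n + 22) e2 ?_ |>.mono (by omega)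
      by_cases hP : P ℒ (update (fun j => s (.var j)) i x)
      · simp only [hP, if_true]
        exact (run_emit i s' htmp).cast (by rw [hvar]; omega) (by rw [hvar])
      · simp only [hP]
        exact (run_pure () s').cast (by simp) (by simp)) ()
  refine e.cast (by simp) ?_
  congr 1
  have : ∀ (L : List Str) (f : Str → Bool) (o : List Bool), L.foldl (fun o x =>
      (if f x then (encodeStr x).reverse else []) ++ o) o =
      ((L.filter f).flatMap encodeStr).reverse ++ o := by
    intro L f
    induction L with
    | nil => simp
    | cons x L ih =>
      intro o
      by_cases h : f x <;> simp [h, ih]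
  exact this _ (fun x => P ℒ (update (fun j => s (.var j)) i x)) _

/-- Comparison of strings by length and then lexicographically, as an automaton. -/
def lenStep (q : Ordering × Bool) (a b : Option Bool) : Ordering × Bool :=
  if q.2 then q else match a, b with
    | some a, some b => (q.1.then (compare a b), false)
    | some _, none => (.gt, true)
    | none, some _ => (.lt, true)
    | none, none => q

def strLT (x y : Str) : Bool := (pairRun lenStep (.eq, false) x y).1 = .lt

/-- The first component of the state compares the bits read so far. The flag is set when exactly one
string has ended; the lengths then override that comparison. -/
theorem pairRun_lenStep (o : Ordering) (x y : Str) :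
    (pairRun lenStep (o, false) x y).1 = .lt ↔
      x.length < y.length ∨ (x.length = y.length ∧ (o = .lt ∨ (o = .eq ∧ x < y))) := by
  induction x generalizing y o with
  | nil =>
    cases y with
    | nil => simp [pairRun]
    | cons b y =>
      rw [pairRun, show lenStep (o, false) none (some b) = (.lt, true) from rfl,
        pairRun_absorb fun _ _ => rfl]
      simp
  | cons a x ih =>
    cases y with
    | nil =>
      rw [pairRun, show lenStep (o, false) (some a) none = (.gt, true) from rfl,
        pairRun_absorb fun _ _ => rfl]
      simp
    | cons b y =>
      rw [pairRun, show lenStep (o, false) (some a) (some b) = (o.then (compare a b), false) from rfl,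
        ih]
      simp only [List.length_cons, add_lt_add_iff_right, add_left_inj, List.cons_lt_cons_iff]
      cases o <;> cases a <;> cases b <;> simp [Ordering.then, compare]

theorem strLT_iff (x y : Str) : strLT x y = true ↔ StrLE x y ∧ x ≠ y := by
  unfold strLT StrLE
  rw [decide_eq_true_iff, pairRun_lenStep]
  simp only [reduceCtorEq, false_or, true_and]
  constructor
  · rintro (h | ⟨h, h'⟩)
    · exact ⟨Or.inl h, by rintro rfl; omega⟩
    · exact ⟨Or.inr ⟨h, h'.le⟩, h'.ne⟩
  · rintro ⟨h | ⟨h, h'⟩, hne⟩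
    · exact Or.inl h
    · exact Or.inr ⟨h, lt_of_le_of_ne h' hne⟩

theorem ev_strLT {d : ℕ} {i j : Fin N} (hij : i ≠ j) : Ev d fun _ env => strLT (env i) (env j) :=
  Ev.atom lenStep (.eq, false) (fun q => decide (q.1 = .lt)) hij

end MultiSel

/-! ### Inserting a constant into the input set, and selecting from it -/

namespace MultiSel

open Function Polynomial Frag

variable {N : ℕ}

theorem eq_sort_of_pairwise {Y : Finset Str} {l : List Str} (hl : l.Pairwise StrLE) (hd : l.Nodup)
    (hm : ∀ x, x ∈ l ↔ x ∈ Y) : l = Y.sort StrLE :=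
  List.Perm.eq_of_pairwise' hl (Y.pairwise_sort StrLE)
    ((List.perm_ext_iff_of_nodup hd (Y.sort_nodup StrLE)).2 fun x => by simp [hm])

theorem sort_filter (Y : Finset Str) (p : Str → Bool) :
    (Y.sort StrLE).filter p = (Y.filter fun x => p x).sort StrLE :=
  eq_sort_of_pairwise ((Y.pairwise_sort StrLE).filter _) ((Y.sort_nodup StrLE).filter _) (by simp)

theorem strLT_irrefl (x : Str) : strLT x x = false := by
  rw [Bool.eq_false_iff, Ne, strLT_iff]
  simp

theorem strLE_of_strLT {x y : Str} (h : strLT x y) : StrLE x y := ((strLT_iff x y).1 h).1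

theorem strLT_or_eq_or_strLT (x y : Str) : strLT x y ∨ x = y ∨ strLT y x := by
  rw [strLT_iff, strLT_iff]
  rcases Std.Total.total (r := StrLE) x y with h | h <;> by_cases h' : x = y <;> tauto

theorem strLT_trans {x y z : Str} (h : strLT x y) (h' : strLT y z) : strLT x z := by
  rw [strLT_iff] at *
  refine ⟨_root_.trans h.1 h'.1, ?_⟩
  rintro rfl
  exact h.2 (antisymm h.1 h'.1)

/-- Both filters are strict, so `z` is listed once whether or not it belongs to `Y`, and no case
distinction is needed in the program. -/
theorem sort_insert_eq (Y : Finset Str) (z : Str) :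
    (Y.sort StrLE).filter (fun x => strLT x z) ++ z :: (Y.sort StrLE).filter (fun x => strLT z x) =
      (insert z Y).sort StrLE := by
  refine eq_sort_of_pairwise ?_ ?_ ?_
  · refine List.pairwise_append.2 ⟨(Y.pairwise_sort StrLE).filter _, List.pairwise_cons.2
      ⟨fun x hx => strLE_of_strLT ((List.mem_filter.1 hx).2), (Y.pairwise_sort StrLE).filter _⟩, ?_⟩
    intro x hx y hy
    have h1 : strLT x z := (List.mem_filter.1 hx).2
    rcases List.mem_cons.1 hy with rfl | hy
    · exact strLE_of_strLT h1
    · exact strLE_of_strLT (strLT_trans h1 ((List.mem_filter.1 hy).2))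
  · refine List.nodup_append.2 ⟨(Y.sort_nodup StrLE).filter _, List.nodup_cons.2
      ⟨fun hx => ?_, (Y.sort_nodup StrLE).filter _⟩, ?_⟩
    · have := (List.mem_filter.1 hx).2
      simp [strLT_irrefl] at this
    intro x hx y hy
    have h1 : strLT x z := (List.mem_filter.1 hx).2
    rintro rfl
    rcases List.mem_cons.1 hy with rfl | hy
    · simp [strLT_irrefl] at h1
    · have := strLT_trans h1 ((List.mem_filter.1 hy).2)
      simp [strLT_irrefl] at this
  · intro x
    have := strLT_or_eq_or_strLT x z
    simp only [List.mem_append, List.mem_filter, Finset.mem_sort, List.mem_cons, Finset.mem_insert]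
    by_cases h : x = z <;> simp_all
    tauto

/-- The store that holds the code of `Y` in `lst false`, the code of `W` in `lst true`. -/
def twoLists (a b : List Bool) : Store (Reg N) :=
  update (update (fun _ => []) (.lst false) a) (.lst true) b

theorem valid_twoLists (ℒ : Bool → List Str) :
    Valid 0 ℒ (twoLists ((ℒ false).flatMap encodeStr) ((ℒ true).flatMap encodeStr) :
      Store (Reg N)) :=
  ⟨fun b => by cases b <;> simp [twoLists], fun b => by simp [twoLists],
    fun i _ => by simp [twoLists], fun i _ => by simp [twoLists]⟩

theorem length_twoLists_le (a b : List Bool) (r : Reg N) :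
    (twoLists a b r).length ≤ a.length + b.length := by
  rcases r with c | c | _ | j | j
  · cases c <;> simp [twoLists]
  all_goals simp [twoLists]

theorem length_encodeSet_insert_le (z : Str) (Y : Finset Str) :
    (encodeSet (insert z Y)).length ≤ (encodeSet Y).length + (encodeStr z).length := by
  by_cases hz : z ∈ Y
  · rw [Finset.insert_eq_of_mem hz]; omega
  · have hp : ((insert z Y).sort StrLE).Perm (z :: Y.sort StrLE) :=
      (List.perm_ext_iff_of_nodup (Finset.sort_nodup _ _) (List.nodup_cons.2
        ⟨by simpa using hz, Finset.sort_nodup _ _⟩)).2 fun x => by simp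
    rw [encodeSet, (hp.flatMap_right encodeStr).length_eq, encodeSet]
    simp; omega

theorem exists_insert (hN : 2 ≤ N) (z : Str) : ∃ (F : Frag (Reg N) Unit) (p : ℕ[X]),
    ∀ Y : Finset Str, F.Run (twoLists (encodeSet Y) []) (p.eval (encodeSet Y).length) ()
      (twoLists (encodeSet Y) (encodeSet (insert z Y))) := by
  have h01 : (⟨0, by omega⟩ : Fin N) ≠ ⟨1, by omega⟩ := by simp
  obtain ⟨F₁, p₁, h₁⟩ := exists_filterTo false (⟨0, by omega⟩ : Fin N) rfl
    (Ev.const z (⟨1, by omega⟩ : Fin N) rfl (ev_strLT h01))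
  obtain ⟨F₂, p₂, h₂⟩ := exists_filterTo false (⟨0, by omega⟩ : Fin N) rfl
    (Ev.const z (⟨1, by omega⟩ : Fin N) rfl (ev_strLT h01.symm))
  simp only [ne_eq, update_self, update_of_ne h01] at h₁ h₂
  refine ⟨F₁.bind fun _ => (pushAll .out (encodeStr z)).bind fun _ => F₂.bind fun _ =>
    move .out (.lst true), p₁ + C (encodeStr z).length + p₂ +
      (3 * (X + C (encodeStr z).length) + 3), fun Y => ?_⟩
  set ℒ : Bool → List Str := fun b => if b then [] else Y.sort StrLE with hℒ
  have hv : Valid 0 ℒ (twoLists (encodeSet Y) [] : Store (Reg N)) := by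
    simpa [hℒ, encodeSet] using valid_twoLists ℒ
  have e1 := h₁ ℒ _ (encodeSet Y).length hv fun r _ => by simpa using length_twoLists_le (encodeSet Y) [] r
  have e2 := run_pushAll .out (encodeStr z) (update (twoLists (encodeSet Y) [] : Store (Reg N)) .out
    ((((ℒ false).filter fun x => strLT x z).flatMap encodeStr).reverse ++
      (twoLists (encodeSet Y) [] : Store (Reg N)) .out))
  set s₂ : Store (Reg N) := update (twoLists (encodeSet Y) []) .out
    ((((ℒ false).filter fun x => strLT x z) ++ [z]).flatMap encodeStr).reverse with hs₂
  have e3 := h₂ ℒ s₂ (encodeSet Y).length ⟨by simpa [hs₂] using hv.lst, by simpa [hs₂] using hv.tmp,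
    by simpa [hs₂] using hv.var, by simpa [hs₂] using hv.cur⟩ fun r hr => by
      simpa [hs₂, hr] using length_twoLists_le (encodeSet Y) [] r
  have e4 := run_move (a := Reg.out) (b := .lst true) (by simp) (encodeSet (insert z Y)).reverse
    (update (twoLists (encodeSet Y) [] : Store (Reg N)) .out (encodeSet (insert z Y)).reverse) (by simp)
  refine Run.cast (Run.bind e1 (Run.bind (e2.cast (s'' := s₂) le_rfl ?_) (Run.bind
    (e3.cast le_rfl ?_) e4))) ?_ ?_
  · simp [hs₂, twoLists]
  · simp [hs₂, encodeSet, ← sort_insert_eq, hℒ]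
  · have := length_encodeSet_insert_le z Y
    simp
    omega
  · funext r
    rcases r with c | c | _ | j | j
    · cases c <;> simp [twoLists]
    all_goals simp [twoLists]

/-- The selected list is collected, reversed, in `out`. Both input lists are erased before it is
moved back, because a machine must halt with all stacks empty except the output stack. -/
theorem exists_select (i : Fin N) (hi : (i : ℕ) = 0)
    {P : (Bool → List Str) → (Fin N → Str) → Bool} (h : Ev 1 P) :
    ∃ (F : Frag (Reg N) Unit) (p : ℕ[X]), ∀ Y W : Finset Str,
      F.Run (twoLists (encodeSet Y) (encodeSet W))
        (p.eval ((encodeSet Y).length + (encodeSet W).length)) ()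
        (twoLists (encodeSet (Y.filter fun x =>
          P (fun b => if b then W.sort StrLE else Y.sort StrLE) (update (fun _ => []) i x))) []) := by
  obtain ⟨F, p, hF⟩ := exists_filterTo false i hi h
  refine ⟨F.bind fun _ => (clear (.lst false)).bind fun _ => (clear (.lst true)).bind fun _ =>
    move .out (.lst false), p + (2 * X + 2) + (2 * X + 2) + (3 * X + 3), fun Y W => ?_⟩
  set ℒ : Bool → List Str := fun b => if b then W.sort StrLE else Y.sort StrLE with hℒ
  have hv : Valid 0 ℒ (twoLists (encodeSet Y) (encodeSet W) : Store (Reg N)) := by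
    simpa [hℒ, encodeSet] using valid_twoLists ℒ
  set p' : Str → Bool := fun x => P ℒ (update (fun _ => []) i x) with hp'
  set Z := Y.filter fun x => p' x with hZ
  have hZe : encodeSet Z = ((ℒ false).filter p').flatMap encodeStr := by
    rw [encodeSet, ← sort_filter]
    simp [hℒ]
  have hZlen : (encodeSet Z).length ≤ (encodeSet Y).length := by
    rw [hZe]
    exact (List.filter_sublist.flatMap encodeStr).length_le
  have e1 := hF ℒ _ _ hv fun r _ => length_twoLists_le (encodeSet Y) (encodeSet W) r
  set s₁ : Store (Reg N) := update (twoLists (encodeSet Y) (encodeSet W)) .out (encodeSet Z).reverse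
    with hs₁
  set s₂ : Store (Reg N) := update (twoLists [] (encodeSet W)) .out (encodeSet Z).reverse with hs₂
  set s₃ : Store (Reg N) := update (twoLists [] []) .out (encodeSet Z).reverse with hs₃
  have e2 := run_clear (.lst false) (encodeSet Y) s₁ (by simp [hs₁, twoLists])
  have e3 := run_clear (.lst true) (encodeSet W) s₂ (by simp [hs₂, twoLists])
  have e4 := run_move (a := Reg.out) (b := .lst false) (by simp) (encodeSet Z).reverse s₃
    (by simp [hs₃])
  refine Run.cast (Run.bind (e1.cast (s'' := s₁) le_rfl ?_) (Run.bind (e2.cast (s'' := s₂) le_rfl ?_)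
    (Run.bind (e3.cast (s'' := s₃) le_rfl ?_) e4))) ?_ ?_
  · rw [hs₁, hZe]
    simp [twoLists, hp']
  · funext r
    rcases r with c | c | _ | j | j
    · cases c <;> simp [twoLists, hs₁, hs₂]
    all_goals simp [twoLists, hs₁, hs₂]
  · funext r
    rcases r with c | c | _ | j | j
    · cases c <;> simp [twoLists, hs₂, hs₃]
    all_goals simp [twoLists, hs₂, hs₃]
  · simp
    omega
  · funext r
    rcases r with c | c | _ | j | j
    · cases c <;> simp [twoLists, hs₃]
    all_goals simp [twoLists, hs₃]

end MultiSel

/-! ### Simulating stack machines and fragments inside a larger `TM2` machine -/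

namespace MultiSel

open Function Turing

/-- The machine `m` goes from `c` to `c'` in `n` steps. -/
def Steps {K Λ σ : Type} {Γ : K → Type} [DecidableEq K] (m : Λ → TM2.Stmt Γ Λ σ) (n : ℕ)
    (c c' : TM2.Cfg Γ Λ σ) : Prop :=
  (flip bind (TM2.step m))^[n] (some c) = some c'

section

variable {K Λ σ : Type} {Γ : K → Type} [DecidableEq K] {m : Λ → TM2.Stmt Γ Λ σ}

theorem Steps.zero (c : TM2.Cfg Γ Λ σ) : Steps m 0 c c := rfl

theorem steps_succ {n : ℕ} {l : Λ} {v : σ} {S : ∀ k, List (Γ k)} {c : TM2.Cfg Γ Λ σ} :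
    Steps m (n + 1) ⟨some l, v, S⟩ c ↔ Steps m n (TM2.stepAux (m l) v S) c := by
  unfold Steps
  rw [iterate_succ_apply]
  rfl

theorem Steps.trans {n n' : ℕ} {a b c : TM2.Cfg Γ Λ σ} (h : Steps m n a b) (h' : Steps m n' b c) :
    Steps m (n + n') a c := by
  unfold Steps at *
  rw [add_comm, iterate_add_apply, h, h']

theorem iterate_step_none (n : ℕ) :
    (flip bind (TM2.step m))^[n] none = (none : Option (TM2.Cfg Γ Λ σ)) :=
  iterate_fixed rfl n

theorem not_steps_succ_of_halted {n : ℕ} {v : σ} {S : ∀ k, List (Γ k)} {c : TM2.Cfg Γ Λ σ} :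
    ¬ Steps m (n + 1) ⟨none, v, S⟩ c := by
  unfold Steps
  rw [iterate_succ_apply, show flip bind (TM2.step m) (some ⟨none, v, S⟩) = none from rfl,
    iterate_step_none]
  simp

/-- Halting configurations are determined by the starting configuration. -/
theorem Steps.halt_unique {n n' : ℕ} {c : TM2.Cfg Γ Λ σ} {v v' : σ} {S S' : ∀ k, List (Γ k)}
    (h : Steps m n c ⟨none, v, S⟩) (h' : Steps m n' c ⟨none, v', S'⟩) : S = S' := by
  wlog hn : n ≤ n' generalizing n n' v v' S S'
  · exact (this h' h (by omega)).symm
  obtain ⟨k, rfl⟩ := Nat.exists_eq_add_of_le' hn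
  unfold Steps at h h'
  rw [iterate_add_apply, h] at h'
  rcases k with _ | k
  · cases h'; rfl
  · exact (not_steps_succ_of_halted h').elim

end

/-- Data for running a stack machine inside another one. -/
structure Emb (K Λ σ : Type) (Γ : K → Type) (K' Λ' σ' : Type) (Γ' : K' → Type) where
  e : K → K'
  e_inj : Injective e
  γ : ∀ k, Γ k → Γ' (e k)
  inv : ∀ k, Γ' (e k) → Option (Γ k)
  inv_γ : ∀ k x, inv k (γ k x) = some x
  lab : Λ → Λ'
  get : σ' → σ
  set : σ → σ' → σ'
  get_set : ∀ v w, get (set v w) = v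

namespace Emb

variable {K Λ σ : Type} {Γ : K → Type} {K' Λ' σ' : Type} {Γ' : K' → Type}
  (E : Emb K Λ σ Γ K' Λ' σ' Γ')

open TM2.Stmt in
/-- Translation of statements; `hlt` is executed instead of halting. -/
def stmt (hlt : TM2.Stmt Γ' Λ' σ') : TM2.Stmt Γ Λ σ → TM2.Stmt Γ' Λ' σ'
  | push k f q => push (E.e k) (fun w => E.γ k (f (E.get w))) (stmt hlt q)
  | peek k f q => peek (E.e k) (fun w o => E.set (f (E.get w) (o.bind (E.inv k))) w) (stmt hlt q)
  | pop k f q => pop (E.e k) (fun w o => E.set (f (E.get w) (o.bind (E.inv k))) w) (stmt hlt q)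
  | load f q => load (fun w => E.set (f (E.get w)) w) (stmt hlt q)
  | branch f q q' => branch (fun w => f (E.get w)) (stmt hlt q) (stmt hlt q')
  | goto f => goto fun w => E.lab (f (E.get w))
  | halt => hlt

/-- The stacks `S'` hold a copy of the stacks `S`, and agree with `S₀` elsewhere. -/
def Rel (S : ∀ k, List (Γ k)) (S₀ S' : ∀ k, List (Γ' k)) : Prop :=
  (∀ k, S' (E.e k) = (S k).map (E.γ k)) ∧ ∀ k, k ∉ Set.range E.e → S' k = S₀ k

variable {E}

theorem head?_bind_inv (k : K) (l : List (Γ k)) :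
    (l.map (E.γ k)).head?.bind (E.inv k) = l.head? := by
  cases l <;> simp [E.inv_γ]

variable [DecidableEq K] [DecidableEq K']

theorem Rel.update {S : ∀ k, List (Γ k)} {S₀ S' : ∀ k, List (Γ' k)} (h : E.Rel S S₀ S') (k : K)
    (l : List (Γ k)) : E.Rel (update S k l) S₀ (update S' (E.e k) (l.map (E.γ k))) := by
  refine ⟨fun j => ?_, fun j hj => ?_⟩
  · by_cases hjk : j = k
    · subst hjk; simp
    · rw [update_of_ne hjk, update_of_ne (E.e_inj.ne hjk), h.1]
  · rw [update_of_ne (by rintro rfl; exact hj ⟨k, rfl⟩), h.2 j hj]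

theorem stepAux_stmt (hlt : TM2.Stmt Γ' Λ' σ') (q : TM2.Stmt Γ Λ σ) (w : σ')
    {S : ∀ k, List (Γ k)} {S₀ S' : ∀ k, List (Γ' k)} (h : E.Rel S S₀ S') :
    ∃ w₁ S₁, E.get w₁ = (TM2.stepAux q (E.get w) S).var ∧
      E.Rel (TM2.stepAux q (E.get w) S).stk S₀ S₁ ∧
      TM2.stepAux (E.stmt hlt q) w S' = match (TM2.stepAux q (E.get w) S).l with
        | some l => ⟨some (E.lab l), w₁, S₁⟩
        | none => TM2.stepAux hlt w₁ S₁ := by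
  induction q generalizing w S S' with
  | push k f q ih =>
    simp only [stmt, TM2.stepAux]
    apply ih
    rw [h.1]
    exact h.update k _
  | peek k f q ih =>
    simp only [stmt, TM2.stepAux]
    rw [h.1, head?_bind_inv]
    simpa only [E.get_set] using ih (E.set (f (E.get w) (S k).head?) w) h
  | pop k f q ih =>
    simp only [stmt, TM2.stepAux]
    rw [h.1, head?_bind_inv, ← List.map_tail]
    simpa only [E.get_set] using ih (E.set (f (E.get w) (S k).head?) w) (h.update k _)
  | load f q ih =>
    simp only [stmt, TM2.stepAux]
    simpa only [E.get_set] using ih (E.set (f (E.get w)) w) h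
  | branch f q q' ih ih' =>
    simp only [stmt, TM2.stepAux]
    cases f (E.get w)
    · exact ih' w h
    · exact ih w h
  | goto f => exact ⟨w, S', rfl, h, rfl⟩
  | halt => exact ⟨w, S', rfl, h, rfl⟩

/-- The simulation is step for step. The statement `hlt` that replaces halting is executed within
the last step, so control passes to the next machine at no cost. -/
theorem steps_stmt {hlt : TM2.Stmt Γ' Λ' σ'} {m : Λ → TM2.Stmt Γ Λ σ} {m' : Λ' → TM2.Stmt Γ' Λ' σ'}
    (hm : ∀ l, m' (E.lab l) = E.stmt hlt (m l)) {n : ℕ} {l : Λ} {w : σ'} {v₁ : σ}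
    {S S₁ : ∀ k, List (Γ k)} {S₀ S' : ∀ k, List (Γ' k)} (h : E.Rel S S₀ S')
    (hs : Steps m n ⟨some l, E.get w, S⟩ ⟨none, v₁, S₁⟩) :
    ∃ w₁ S₁', E.get w₁ = v₁ ∧ E.Rel S₁ S₀ S₁' ∧
      Steps m' n ⟨some (E.lab l), w, S'⟩ (TM2.stepAux hlt w₁ S₁') := by
  induction n generalizing l w S S' with
  | zero => simp [Steps] at hs
  | succ n ih =>
    rw [steps_succ] at hs
    obtain ⟨w₂, S₂, h1, h2, h3⟩ := E.stepAux_stmt hlt (m l) w h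
    generalize TM2.stepAux (m l) (E.get w) S = c at *
    obtain ⟨_ | l', v₂, S₃⟩ := c
    · rcases n with _ | n
      · cases hs
        refine ⟨w₂, S₂, h1, h2, ?_⟩
        rw [steps_succ, hm, h3]
        exact Steps.zero _
      · exact (not_steps_succ_of_halted hs).elim
    · simp only at h1 h2 h3
      subst h1
      obtain ⟨w₁, S₁', h4, h5, h6⟩ := ih h2 hs
      refine ⟨w₁, S₁', h4, h5, ?_⟩
      rw [steps_succ, hm, h3]
      exact h6

end Emb

/-- Data for running a fragment inside a stack machine whose local state has a component that
stores a popped symbol. -/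
structure FragEmb (R X K' Λ' : Type) (Γ' : K' → Type) where
  e : R → K'
  e_inj : Injective e
  α : ∀ r, Γ' (e r) ≃ Bool
  lab : X → Λ'

namespace FragEmb

variable {R X K' Λ' σ : Type} {Γ' : K' → Type} (E : FragEmb R X K' Λ' Γ')

open TM2.Stmt in
def stmt : Instr R X → TM2.Stmt Γ' Λ' (σ × Option Bool)
  | .jump x => goto fun _ => E.lab x
  | .push r b x => push (E.e r) (fun _ => (E.α r).symm b) (goto fun _ => E.lab x)
  | .pop r g => pop (E.e r) (fun w o => (w.1, o.map (E.α r))) (goto fun w => E.lab (g w.2))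

def Rel (s : Store R) (S₀ S' : ∀ k, List (Γ' k)) : Prop :=
  (∀ r, S' (E.e r) = (s r).map (E.α r).symm) ∧ ∀ k, k ∉ Set.range E.e → S' k = S₀ k

variable [DecidableEq R] [DecidableEq K']

variable {E}

theorem Rel.update {s : Store R} {S₀ S' : ∀ k, List (Γ' k)} (h : E.Rel s S₀ S') (r : R)
    (l : List Bool) : E.Rel (update s r l) S₀ (update S' (E.e r) (l.map (E.α r).symm)) := by
  refine ⟨fun j => ?_, fun j hj => ?_⟩
  · by_cases hjk : j = r
    · subst hjk; simp
    · rw [update_of_ne hjk, update_of_ne (E.e_inj.ne hjk), h.1]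
  · rw [update_of_ne (by rintro rfl; exact hj ⟨r, rfl⟩), h.2 j hj]

theorem stepAux_stmt (I : Instr R X) (w : σ × Option Bool) {s : Store R}
    {S₀ S' : ∀ k, List (Γ' k)} (h : E.Rel s S₀ S') :
    ∃ w₁ S₁, w₁.1 = w.1 ∧ E.Rel (I.exec s).2 S₀ S₁ ∧
      TM2.stepAux (E.stmt I) w S' = ⟨some (E.lab (I.exec s).1), w₁, S₁⟩ := by
  cases I with
  | jump x => exact ⟨w, S', rfl, h, rfl⟩
  | push r b x =>
    refine ⟨w, _, rfl, h.update r (b :: s r), ?_⟩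
    simp [stmt, TM2.stepAux, Instr.exec, h.1]
  | pop r g =>
    refine ⟨(w.1, (s r).head?), _, rfl, h.update r (s r).tail, ?_⟩
    simp only [stmt, TM2.stepAux, Instr.exec, h.1, List.map_tail]
    congr 3
    all_goals cases s r <;> simp

/-- The conclusion `w₁.1 = w.1` matters: a fragment touches only the symbol component of the local
state, so a machine started after it still finds its own initial state. -/
theorem steps_stmt {A : Type} {F : Frag R A} {E : FragEmb R (F.Λ ⊕ A) K' Λ' Γ'}
    {m' : Λ' → TM2.Stmt Γ' Λ' (σ × Option Bool)}
    (hm : ∀ l, m' (E.lab (Sum.inl l)) = E.stmt (F.code l)) {t : ℕ} {s s₁ : Store R} {a : A}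
    (hs : F.Run s t a s₁) (w : σ × Option Bool) {S₀ S' : ∀ k, List (Γ' k)} (h : E.Rel s S₀ S') :
    ∃ n ≤ t, ∃ w₁ S₁', w₁.1 = w.1 ∧ E.Rel s₁ S₀ S₁' ∧
      Steps m' n ⟨some (E.lab F.entry), w, S'⟩ ⟨some (E.lab (Sum.inr a)), w₁, S₁'⟩ := by
  unfold Frag.Run at hs
  generalize F.entry = x at hs ⊢
  induction t generalizing x s w S' with
  | zero =>
    cases hs
    exact ⟨0, le_rfl, w, S', rfl, h, Steps.zero _⟩
  | succ t ih =>
    rcases x with l | a'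
    · rw [iterate_succ_apply] at hs
      obtain ⟨w₁, S₁, h1, h2, h3⟩ := E.stepAux_stmt (F.code l) w h
      obtain ⟨n, hn, w₂, S₂, h4, h5, h6⟩ := ih w₁ h2 _ hs
      refine ⟨n + 1, by omega, w₂, S₂, h4.trans h1, h5, ?_⟩
      rw [steps_succ, hm, h3]
      exact h6
    · rw [Frag.step_iterate_exit] at hs
      cases hs
      exact ⟨0, by omega, w, S', rfl, h, Steps.zero _⟩

end FragEmb

end MultiSel

/-! ### Running a fragment, a given machine and another fragment in sequence -/

namespace MultiSel

open Function Turing Polynomial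

variable {N : ℕ}

theorem initList_self (M : FinTM2) (l : List (M.Γ M.k₀)) : (initList M l).stk M.k₀ = l := by
  simp [initList]

theorem initList_of_ne (M : FinTM2) (l : List (M.Γ M.k₀)) {k : M.K} (h : k ≠ M.k₀) :
    (initList M l).stk k = [] := by
  simp [initList, h]

theorem haltList_self (M : FinTM2) (l : List (M.Γ M.k₁)) : (haltList M l).stk M.k₁ = l := by
  simp [haltList]

theorem haltList_of_ne (M : FinTM2) (l : List (M.Γ M.k₁)) {k : M.K} (h : k ≠ M.k₁) :
    (haltList M l).stk k = [] := by
  simp [haltList, h]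

section

variable {K : Type}

/-- The register `lst true` is identified with the stack `k`. -/
def regStack (k : K) : Reg N → K ⊕ Reg N
  | .lst true => .inl k
  | .lst false => .inr (.lst false)
  | .tmp b => .inr (.tmp b)
  | .out => .inr .out
  | .var i => .inr (.var i)
  | .cur i => .inr (.cur i)

theorem regStack_of_ne (k : K) {r : Reg N} (h : r ≠ .lst true) : regStack k r = .inr r := by
  rcases r with c | c | _ | j | j
  · cases c
    · rfl
    · exact (h rfl).elim
  all_goals rfl

theorem regStack_injective (k : K) : Injective (regStack k : Reg N → K ⊕ Reg N) := by
  intro r r' h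
  by_cases h1 : r = .lst true <;> by_cases h2 : r' = .lst true
  · rw [h1, h2]
  · rw [regStack_of_ne k h2, h1] at h; cases h
  · rw [regStack_of_ne k h1, h2] at h; cases h
  · rw [regStack_of_ne k h1, regStack_of_ne k h2] at h; exact Sum.inr_injective h

/-- Alphabets of the stacks of a machine together with registers. -/
abbrev SumΓ (N : ℕ) (Γ : K → Type) : K ⊕ Reg N → Type := Sum.elim Γ fun _ => Bool

def regAlph {Γ : K → Type} (k : K) (α : Γ k ≃ Bool) : ∀ r : Reg N, SumΓ N Γ (regStack k r) ≃ Bool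
  | .lst true => α
  | .lst false => Equiv.refl Bool
  | .tmp _ => Equiv.refl Bool
  | .out => Equiv.refl Bool
  | .var _ => Equiv.refl Bool
  | .cur _ => Equiv.refl Bool

def regFragEmb {X Λ' : Type} {Γ : K → Type} (k : K) (α : Γ k ≃ Bool) (lab : X → Λ') :
    FragEmb (Reg N) X (K ⊕ Reg N) Λ' (SumΓ N Γ) where
  e := regStack k
  e_inj := regStack_injective k
  α := regAlph k α
  lab := lab

/-- The embedding of a machine among additional registers and control states. -/
def machEmb {Λ σ Λ' : Type} {Γ : K → Type} (lab : Λ → Λ') :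
    Emb K Λ σ Γ (K ⊕ Reg N) Λ' (σ × Option Bool) (SumΓ N Γ) where
  e := Sum.inl
  e_inj := Sum.inl_injective
  γ _ x := x
  inv _ x := some x
  inv_γ _ _ := rfl
  lab := lab
  get := Prod.fst
  set v w := (v, w.2)
  get_set _ _ := rfl

/-- The stacks of a machine and registers together. -/
def sumStk {Γ : K → Type} (S : ∀ k, List (Γ k)) (s : Store (Reg N)) :
    ∀ k, List (SumΓ N Γ k)
  | .inl k => S k
  | .inr r => s r

theorem rel_regFragEmb {X Λ' : Type} {Γ : K → Type} {k : K} {α : Γ k ≃ Bool} {lab : X → Λ'}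
    {S : ∀ k, List (Γ k)} {a b : List Bool} (h : S k = b.map α.symm) :
    (regFragEmb k α lab : FragEmb (Reg N) X (K ⊕ Reg N) Λ' (SumΓ N Γ)).Rel
      (twoLists a b) (sumStk S (twoLists a [])) (sumStk S (twoLists a [])) := by
  refine ⟨fun r => ?_, fun _ _ => rfl⟩
  rcases r with c | c | _ | j | j
  · cases c
    · change twoLists a [] (.lst false) = (twoLists a b (.lst false)).map id
      simp [twoLists]
    · change S k = (twoLists a b (.lst true)).map α.symm
      rw [h]
      simp [twoLists]
  all_goals simp [regFragEmb, regStack, regAlph, sumStk, twoLists]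

theorem eq_of_rel_regFragEmb {X Λ' : Type} {Γ : K → Type} {k : K} {α : Γ k ≃ Bool} {lab : X → Λ'}
    {S S₁ : ∀ k, List (Γ k)} {a a' b : List Bool} {S' : ∀ k, List (SumΓ N Γ k)}
    (h : (regFragEmb k α lab : FragEmb (Reg N) X (K ⊕ Reg N) Λ' (SumΓ N Γ)).Rel
      (twoLists a b) (sumStk S (twoLists a' [])) S')
    (hk : S₁ k = b.map α.symm) (hS : ∀ j, j ≠ k → S₁ j = S j) : S' = sumStk S₁ (twoLists a []) := by
  funext j
  rcases j with j | r
  · by_cases hj : j = k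
    · subst hj
      have := h.1 (.lst true)
      simp only [regFragEmb, regStack, regAlph, twoLists, update_self] at this
      rw [this]
      exact hk.symm
    · rw [h.2 (.inl j), sumStk, sumStk, hS j hj]
      rintro ⟨r, hr⟩
      by_cases h1 : r = .lst true
      · rw [h1] at hr
        exact hj (Sum.inl_injective hr).symm
      · rw [show (regFragEmb k α lab).e r = .inr r from regStack_of_ne k h1] at hr
        cases hr
  · by_cases h1 : r = .lst true
    · rw [h.2 (.inr r), h1, sumStk, sumStk]
      · simp [twoLists]
      · rintro ⟨r', hr⟩
        by_cases h2 : r' = .lst true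
        · rw [h2] at hr; cases hr
        · rw [show (regFragEmb k α lab).e r' = .inr r' from regStack_of_ne k h2] at hr
          exact h2 ((Sum.inr_injective hr).trans h1)
    · have := h.1 r
      rcases r with c | c | _ | j | j
      · cases c
        · change S' (.inr (.lst false)) = (twoLists a b (.lst false)).map id at this
          rw [this]
          simp [twoLists, sumStk]
        · exact (h1 rfl).elim
      all_goals simpa [regFragEmb, regStack, regAlph, twoLists, sumStk] using this

end

section

variable (A B : Frag (Reg N) Unit) (M : FinTM2) (αi : M.Γ M.k₀ ≃ Bool) (αo : M.Γ M.k₁ ≃ Bool)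

/-- Control states of the machine that runs `A`, `M` and `B` one after the other. -/
abbrev ChainΛ : Type := A.Λ ⊕ M.Λ ⊕ B.Λ ⊕ Unit

def chainA : FragEmb (Reg N) (A.Λ ⊕ Unit) (M.K ⊕ Reg N) (ChainΛ A B M) (SumΓ N M.Γ) :=
  regFragEmb M.k₀ αi (Sum.elim Sum.inl fun _ => Sum.inr (Sum.inl M.main))

def chainM : Emb M.K M.Λ M.σ M.Γ (M.K ⊕ Reg N) (ChainΛ A B M) (M.σ × Option Bool) (SumΓ N M.Γ) :=
  machEmb fun l => Sum.inr (Sum.inl l)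

def chainB : FragEmb (Reg N) (B.Λ ⊕ Unit) (M.K ⊕ Reg N) (ChainΛ A B M) (SumΓ N M.Γ) :=
  regFragEmb M.k₁ αo (Sum.elim (fun l => Sum.inr (Sum.inr (Sum.inl l)))
    fun _ => Sum.inr (Sum.inr (Sum.inr ())))

def chainCode : ChainΛ A B M → TM2.Stmt (SumΓ N M.Γ) (ChainΛ A B M) (M.σ × Option Bool)
  | .inl l => (chainA A B M αi).stmt (A.code l)
  | .inr (.inl l) => (chainM A B M).stmt (.goto fun _ => (chainB A B M αo).lab B.entry) (M.m l)
  | .inr (.inr (.inl l)) => (chainB A B M αo).stmt (B.code l)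
  -- `haltList` prescribes the initial local state in the final configuration.
  | .inr (.inr (.inr _)) => .load (fun _ => (M.initialState, none)) .halt

/-- No data are copied between the stages: `lst true` is the input stack of `M` for the fragment `A`
and the output stack of `M` for the fragment `B`, while `lst false` keeps the original input out of
the reach of `M`. The extra step resets the local state. -/
theorem steps_chain {a b a' b' c : List Bool} {tA tM tB : ℕ}
    (hA : A.Run (twoLists a []) tA () (twoLists a' b))
    (hM : TM2OutputsInTime M (b.map αi.invFun) (some (b'.map αo.invFun)) tM)
    (hB : B.Run (twoLists a' b') tB () (twoLists c [])) :
    ∃ n ≤ tA + tM + tB + 1, Steps (chainCode A B M αi αo) n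
      ⟨some ((chainA A B M αi).lab A.entry), (M.initialState, none),
        sumStk (fun _ => []) (twoLists a [])⟩
      ⟨none, (M.initialState, none), sumStk (fun _ => []) (twoLists c [])⟩ := by
  obtain ⟨n₁, hn₁, w₁, S₁, hw₁, hS₁, h₁⟩ := FragEmb.steps_stmt (E := chainA A B M αi)
    (m' := chainCode A B M αi αo) (fun _ => rfl) hA (M.initialState, none)
    (rel_regFragEmb (S := fun _ => []) rfl)
  have hS₁' := eq_of_rel_regFragEmb (S₁ := (initList M (b.map αi.invFun)).stk) hS₁
    (initList_self M _) fun j hj => initList_of_ne M _ hj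
  subst hS₁'
  obtain ⟨⟨n₂, hM⟩, hn₂⟩ := hM
  have hM' : Steps M.m n₂ ⟨some M.main, w₁.1, (initList M (b.map αi.invFun)).stk⟩
      ⟨none, M.initialState, (haltList M (b'.map αo.invFun)).stk⟩ := by
    rw [hw₁]
    exact hM
  obtain ⟨w₂, S₂, hw₂, hS₂, h₂⟩ := Emb.steps_stmt (E := chainM A B M)
    (hlt := .goto fun _ => (chainB A B M αo).lab B.entry)
    (m' := chainCode A B M αi αo) (fun _ => rfl) (w := w₁)
    (S₀ := sumStk (initList M (b.map αi.invFun)).stk (twoLists a' []))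
    (S' := sumStk (initList M (b.map αi.invFun)).stk (twoLists a' []))
    ⟨fun k => (List.map_id _).symm, fun _ _ => rfl⟩ hM'
  have hS₂' : S₂ = sumStk (haltList M (b'.map αo.invFun)).stk (twoLists a' []) := by
    funext k
    rcases k with k | r
    · exact (hS₂.1 k).trans (List.map_id _)
    · exact hS₂.2 (.inr r) (by rintro ⟨k, hk⟩; cases hk)
  subst hS₂'
  obtain ⟨n₃, hn₃, w₃, S₃, hw₃, hS₃, h₃⟩ := FragEmb.steps_stmt (E := chainB A B M αo)
    (m' := chainCode A B M αi αo) (fun _ => rfl) hB w₂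
    (rel_regFragEmb (haltList_self M _))
  have hS₃' := eq_of_rel_regFragEmb (S₁ := fun _ => []) hS₃ rfl fun j hj =>
    (haltList_of_ne M _ hj).symm
  subst hS₃'
  refine ⟨n₁ + (n₂ + (n₃ + 1)), by dsimp only at hn₂; omega, h₁.trans (h₂.trans (h₃.trans ?_))⟩
  rw [show (chainB A B M αo).lab (Sum.inr ()) = Sum.inr (Sum.inr (Sum.inr ())) from rfl, steps_succ]
  exact Steps.zero _

noncomputable def chain : FinTM2 :=
  letI := Fintype.ofFinite A.Λ
  letI := Fintype.ofFinite B.Λ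
  letI := Fintype.ofFinite (Reg N)
  letI := M.kDecidableEq
  letI := M.kFin
  letI := M.ΛFin
  letI := M.σFin
  { K := M.K ⊕ Reg N
    k₀ := .inr (.lst false)
    k₁ := .inr (.lst false)
    Γ := SumΓ N M.Γ
    Λ := ChainΛ A B M
    main := (chainA A B M αi).lab A.entry
    σ := M.σ × Option Bool
    initialState := (M.initialState, none)
    Γk₀Fin := inferInstanceAs (Fintype Bool)
    m := chainCode A B M αi αo }

theorem stk_eq_sumStk (T : ∀ k, List (SumΓ N M.Γ k)) (l : List Bool)
    (h : T (.inr (.lst false)) = l) (h' : ∀ k, k ≠ .inr (.lst false) → T k = []) :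
    T = sumStk (fun _ => []) (twoLists l []) := by
  funext k
  by_cases hk : k = .inr (.lst false)
  · subst hk; simp [h, sumStk, twoLists]
  · rw [h' k hk]
    rcases k with k | r
    · rfl
    · rcases r with c | c | _ | j | j
      · cases c
        · exact (hk rfl).elim
        · simp [sumStk, twoLists]
      all_goals simp [sumStk, twoLists]

theorem initList_chain (l : List Bool) : initList (chain A B M αi αo) l =
    ⟨some ((chainA A B M αi).lab A.entry), (M.initialState, none),
        sumStk (fun _ => []) (twoLists l [])⟩ := by
  refine congrArg (TM2.Cfg.mk _ _) (stk_eq_sumStk M _ l ?_ fun k hk => ?_)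
  · exact initList_self (chain A B M αi αo) l
  · exact initList_of_ne (chain A B M αi αo) l hk

theorem haltList_chain (l : List Bool) : haltList (chain A B M αi αo) l =
    ⟨none, (M.initialState, none), sumStk (fun _ => []) (twoLists l [])⟩ := by
  refine congrArg (TM2.Cfg.mk _ _) (stk_eq_sumStk M _ l ?_ fun k hk => ?_)
  · exact haltList_self (chain A B M αi αo) l
  · exact haltList_of_ne (chain A B M αi αo) l hk

end

/-- Polynomial-time selection of strings by a predicate evaluated on the input `Y` and on the value
of a polynomial-time function at `insert z Y`. -/
theorem isPolyTime_select (hN : 2 ≤ N) {f : Finset Str → Finset Str} (hf : IsPolyTime f) (z : Str)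
    (hlen : ∀ Y, (encodeSet (f (insert z Y))).length ≤ (encodeSet (insert z Y)).length) (i : Fin N)
    (hi : (i : ℕ) = 0) {P : (Bool → List Str) → (Fin N → Str) → Bool} (hP : Ev 1 P) :
    IsPolyTime fun Y => Y.filter fun x =>
      P (fun b => if b then (f (insert z Y)).sort StrLE else Y.sort StrLE)
        (update (fun _ => []) i x) := by
  obtain ⟨M, hfin⟩ := hf
  obtain ⟨A, pA, hA⟩ := exists_insert hN z
  obtain ⟨B, pB, hB⟩ := exists_select i hi hP
  refine ⟨⟨⟨chain A B M.tm M.inputAlphabet M.outputAlphabet, Equiv.refl Bool, Equiv.refl Bool⟩,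
    pA + M.time.comp (X + C (encodeStr z).length) + pB.comp (2 * X + C (encodeStr z).length) + 1,
    fun Y => ?_⟩, ?_⟩
  · have h := steps_chain A B M.tm M.inputAlphabet M.outputAlphabet (hA Y)
      (M.outputsFun (insert z Y)) (hB Y (f (insert z Y)))
    refine ⟨⟨h.choose, ?_⟩, h.choose_spec.1.trans ?_⟩
    · have h' := h.choose_spec.2
      have hid : ∀ l : List Bool, l.map (Equiv.refl Bool).invFun = l := List.map_id
      have e1 := (congrArg (initList (chain A B M.tm M.inputAlphabet M.outputAlphabet))
        (hid (encodeSet Y))).trans (initList_chain A B M.tm M.inputAlphabet M.outputAlphabet _)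
      have e2 := (congrArg (haltList (chain A B M.tm M.inputAlphabet M.outputAlphabet))
        (hid (encodeSet (Y.filter fun x =>
          P (fun b => if b then (f (insert z Y)).sort StrLE else Y.sort StrLE)
            (update (fun _ => []) i x))))).trans
        (haltList_chain A B M.tm M.inputAlphabet M.outputAlphabet _)
      exact (congrArg (fun c => (flip bind (chain A B M.tm M.inputAlphabet M.outputAlphabet).step)^[_]
        (some c)) e1).trans (Eq.trans h' (congrArg some e2.symm))
    · have h1 := length_encodeSet_insert_le z Y
      have h2 := eval_le_eval_of_le M.time h1
      -- The running time of `B` depends on the output of `M`, whose length `hlen` bounds by that of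
      -- the code of `insert z Y`.
      have h3 := eval_le_eval_of_le pB (Nat.add_le_add_left ((hlen Y).trans h1) (encodeSet Y).length)
      simp only [eval_add, eval_comp, eval_X, eval_C, eval_mul, eval_ofNat, eval_one]
      rw [show 2 * (encodeSet Y).length + (encodeStr z).length =
        (encodeSet Y).length + ((encodeSet Y).length + (encodeStr z).length) by ring]
      omega
  · rintro (k | r)
    · exact hfin k
    · exact inferInstanceAs (Finite Bool)

end MultiSel

/-! ### Countability of the polynomial-time functions -/

namespace MultiSel

open Function Turing

theorem encodeStr_append_inj {x y : Str} {l l' : List Bool}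
    (h : encodeStr x ++ l = encodeStr y ++ l') : x = y ∧ l = l' := by
  induction x generalizing y with
  | nil =>
    cases y with
    | nil => simpa [Frag.encodeStr_nil] using h
    | cons b y => simp [Frag.encodeStr_nil, Frag.encodeStr_cons] at h
  | cons a x ih =>
    cases y with
    | nil => simp [Frag.encodeStr_nil, Frag.encodeStr_cons] at h
    | cons b y =>
      simp only [Frag.encodeStr_cons, List.cons_append, List.cons.injEq, true_and] at h
      obtain ⟨h1, h2⟩ := ih h.2
      exact ⟨by rw [h.1, h1], h2⟩

theorem flatMap_encodeStr_injective : Injective fun L : List Str => L.flatMap encodeStr := by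
  intro L L' h
  induction L generalizing L' with
  | nil =>
    cases L' with
    | nil => rfl
    | cons y L' =>
      have := congrArg List.length h
      simp [Frag.length_encodeStr] at this
      try omega
  | cons x L ih =>
    cases L' with
    | nil =>
      have := congrArg List.length h
      simp [Frag.length_encodeStr] at this
      try omega
    | cons y L' =>
      obtain ⟨h1, h2⟩ := encodeStr_append_inj (by simpa using h)
      rw [h1, ih h2]

theorem encodeSet_injective : Injective encodeSet := by
  intro Y Y' h
  have := congrArg List.toFinset (flatMap_encodeStr_injective h)
  simpa using this

section

variable {K G Λ σ : Type}

/-- Nodes of the syntax trees of statements. -/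
abbrev StmtNode (K G Λ σ : Type) : Type :=
  (K × (σ → G)) ⊕ (K × (σ → Option G → σ)) ⊕ (K × (σ → Option G → σ)) ⊕ (σ → σ) ⊕ (σ → Bool) ⊕
    (σ → Λ) ⊕ Unit

/-- Polish notation for statements. -/
def polish : TM2.Stmt (fun _ : K => G) Λ σ → List (StmtNode K G Λ σ)
  | .push k f q => .inl (k, f) :: polish q
  | .peek k f q => .inr (.inl (k, f)) :: polish q
  | .pop k f q => .inr (.inr (.inl (k, f))) :: polish q
  | .load f q => .inr (.inr (.inr (.inl f))) :: polish q
  | .branch f q q' => .inr (.inr (.inr (.inr (.inl f)))) :: (polish q ++ polish q')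
  | .goto f => [.inr (.inr (.inr (.inr (.inr (.inl f)))))]
  | .halt => [.inr (.inr (.inr (.inr (.inr (.inr ())))))]

/-- Polish notation is uniquely readable even with a continuation `l`; the continuation is what
makes the induction pass through the two subtrees of a branch. -/
theorem polish_append_inj (q q' : TM2.Stmt (fun _ : K => G) Λ σ) (l l' : List (StmtNode K G Λ σ))
    (h : polish q ++ l = polish q' ++ l') : q = q' ∧ l = l' := by
  induction q generalizing q' l l' with
  | branch f q₁ q₂ ih₁ ih₂ =>
    cases q' <;> simp only [polish, List.cons_append, List.cons.injEq, Sum.inr.injEq, Sum.inl.injEq,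
      reduceCtorEq, false_and, List.append_assoc] at h
    obtain ⟨h1, h2⟩ := ih₁ _ _ _ h.2
    obtain ⟨h3, h4⟩ := ih₂ _ _ _ h2
    exact ⟨by rw [h.1, h1, h3], h4⟩
  | goto f =>
    cases q' <;> simp [polish] at h
    exact ⟨by rw [h.1], h.2⟩
  | halt =>
    cases q' <;> simp [polish] at h
    exact ⟨rfl, h⟩
  | load f q ih =>
    cases q' <;> simp only [polish, List.cons_append, List.cons.injEq, Sum.inr.injEq, Sum.inl.injEq,
      reduceCtorEq, false_and] at h
    obtain ⟨h1, h2⟩ := ih _ _ _ h.2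
    exact ⟨by rw [h.1, h1], h2⟩
  | push k f q ih | peek k f q ih | pop k f q ih =>
    cases q' <;> simp only [polish, List.cons_append, List.cons.injEq, Sum.inr.injEq, Sum.inl.injEq,
      reduceCtorEq, false_and, Prod.mk.injEq] at h
    obtain ⟨h1, h2⟩ := ih _ _ _ h.2
    obtain ⟨⟨rfl, rfl⟩, -⟩ := h
    exact ⟨by rw [h1], h2⟩

instance [Countable K] [Countable G] [Countable Λ] [Finite σ] [Finite G] :
    Countable (TM2.Stmt (fun _ : K => G) Λ σ) :=
  Injective.countable (f := polish) fun q q' h => (polish_append_inj q q' [] [] (by rw [h])).1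

end

/-- Machines with initial segments of `ℕ` as sets of stacks, symbols, labels and states, together
with the symbols that stand for the bits in the input and in the output. -/
abbrev Code : Type :=
  Σ p : ℕ × ℕ × ℕ × ℕ, (Fin p.2.2.1 → TM2.Stmt (fun _ : Fin p.1 => Fin p.2.1) (Fin p.2.2.1)
    (Fin p.2.2.2)) × (Fin p.1 × Fin p.1 × Fin p.2.2.1 × Fin p.2.2.2) ×
    (Bool → Fin p.2.1) × (Bool → Fin p.2.1)

/-- Time bounds are irrelevant for counting and are left out. Injectivity of the output symbols lets
the output be decoded. -/
def Code.Computes (c : Code) (f : Finset Str → Finset Str) : Prop :=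
  Injective c.2.2.2.2 ∧ ∀ Y, ∃ n v S, Steps c.2.1 n
    ⟨some c.2.2.1.2.2.1, c.2.2.1.2.2.2,
      update (fun _ => []) c.2.2.1.1 ((encodeSet Y).map c.2.2.2.1)⟩ ⟨none, v, S⟩ ∧
    S c.2.2.1.2.1 = (encodeSet (f Y)).map c.2.2.2.2

/-- The machine is deterministic, so its halting stacks are determined by the input, and `encodeSet`
is injective. -/
theorem Code.Computes.unique {c : Code} {f g : Finset Str → Finset Str} (hf : c.Computes f)
    (hg : c.Computes g) : f = g := by
  funext Y
  obtain ⟨n, v, S, h1, h2⟩ := hf.2 Y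
  obtain ⟨n', v', S', h1', h2'⟩ := hg.2 Y
  rw [h1.halt_unique h1', h2'] at h2
  exact (encodeSet_injective (hf.1.list_map h2)).symm

/-- Stacks, symbols, labels and states are all finite and can be renamed to initial segments of `ℕ`.
This is where finiteness of every work alphabet is used. -/
theorem exists_code {f : Finset Str → Finset Str} (hf : IsPolyTime f) :
    ∃ c : Code, c.Computes f := by
  classical
  obtain ⟨⟨⟨M, αi, αo⟩, p, hM⟩, hfin⟩ := hf
  dsimp only at hfin hM
  have := M.kFin
  have := M.ΛFin
  have := M.σFin
  have eK := Finite.equivFin M.K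
  have eΛ := Finite.equivFin M.Λ
  have eσ := Finite.equivFin M.σ
  have eG := Finite.equivFin (Σ k, M.Γ k)
  let E : Emb M.K M.Λ M.σ M.Γ _ _ _ (fun _ => Fin (Nat.card (Σ k, M.Γ k))) :=
    { e := eK
      e_inj := eK.injective
      γ := fun k x => eG ⟨k, x⟩
      -- All stacks share one alphabet, whose symbols are pairs of a stack and a symbol of that
      -- stack; decoding on stack `k` is therefore partial.
      inv := fun k y => if h : (eG.symm y).1 = k then some (h ▸ (eG.symm y).2) else none
      inv_γ := by
        intro k x
        have : ∀ y : Σ k, M.Γ k, y = ⟨k, x⟩ →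
            (if h : y.1 = k then some (h ▸ y.2) else none) = some x := by
          rintro _ rfl
          simp
        exact this _ (eG.symm_apply_apply _)
      lab := eΛ
      get := eσ.symm
      set := fun v _ => eσ v
      get_set := by simp }
  refine ⟨⟨(_, _, _, _), fun l => E.stmt .halt (M.m (eΛ.symm l)),
    (eK M.k₀, eK M.k₁, eΛ M.main, eσ M.initialState),
    fun b => eG ⟨M.k₀, αi.symm b⟩, fun b => eG ⟨M.k₁, αo.symm b⟩⟩, ?_, fun Y => ?_⟩
  · intro a b h
    have := eG.injective h
    simpa using this
  · obtain ⟨⟨n, hn⟩, -⟩ := hM Y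
    have hs : Steps M.m n ⟨some M.main, eσ.symm (eσ M.initialState),
        (initList M ((encodeSet Y).map αi.invFun)).stk⟩
        ⟨none, M.initialState, (haltList M ((encodeSet (f Y)).map αo.invFun)).stk⟩ := by
      rw [Equiv.symm_apply_apply]
      exact hn
    have hin : ∀ k, update (fun _ => []) (eK M.k₀) ((encodeSet Y).map fun b => eG ⟨M.k₀, αi.symm b⟩)
        (eK k) = ((initList M ((encodeSet Y).map αi.invFun)).stk k).map fun x => eG ⟨k, x⟩ := by
      intro k
      by_cases hk : k = M.k₀
      · subst hk
        rw [update_self, initList_self, List.map_map]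
        rfl
      · rw [update_of_ne (eK.injective.ne hk), initList_of_ne M _ hk]
        rfl
    obtain ⟨w₁, S₁, -, h2, h3⟩ := Emb.steps_stmt (E := E) (hlt := .halt)
      (m' := fun l => E.stmt .halt (M.m (eΛ.symm l))) (fun l => by simp [E])
      (w := eσ M.initialState) (S₀ := fun _ => [])
      ⟨hin, fun k hk => (hk ⟨eK.symm k, by simp [E]⟩).elim⟩ hs
    refine ⟨n, w₁, S₁, h3, (h2.1 M.k₁).trans ?_⟩
    rw [haltList_self, List.map_map]
    rfl

theorem countable_isPolyTime : {f : Finset Str → Finset Str | IsPolyTime f}.Countable := by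
  choose c hc using fun f : {f : Finset Str → Finset Str | IsPolyTime f} => exists_code f.2
  exact (Injective.countable (f := c) fun f g h =>
    Subtype.ext ((hc f).unique (h ▸ hc g)) : Countable _)

end MultiSel

/-! ### The inclusions -/

namespace MultiSel

open Function

theorem countP_sort (Y : Finset Str) (p : Str → Bool) :
    (Y.sort StrLE).countP p = (Y.filter fun x => p x).card := by
  rw [List.countP_eq_length_filter, sort_filter, Finset.length_sort]

theorem length_encodeSet_le_of_subset {W Y : Finset Str} (h : W ⊆ Y) :
    (encodeSet W).length ≤ (encodeSet Y).length := by
  have : W = Y.filter fun x => decide (x ∈ W) := by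
    ext x
    simpa using fun hx => h hx
  rw [this, encodeSet, ← sort_filter]
  exact (List.Sublist.flatMap List.filter_sublist encodeStr).length_le

/-- The elements of `S` with fewer than `k` predecessors in `S`. -/
def firstFew (k : ℕ) (S : Finset Str) : Finset Str :=
  S.filter fun x => (S.filter fun y => strLT y x).card < k

theorem firstFew_subset (k : ℕ) (S : Finset Str) : firstFew k S ⊆ S := Finset.filter_subset _ _

/-- The rank of a string, its number of predecessors in `S`, is a bijection from `S` onto the
numbers below `S.card`. -/
theorem card_firstFew (k : ℕ) (S : Finset Str) : (firstFew k S).card = min k S.card := by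
  set r : Str → ℕ := fun x => (S.filter fun y => strLT y x).card with hr
  have hlt : ∀ x ∈ S, ∀ y, strLT x y → r x < r y := fun x hx y h => by
    refine Finset.card_lt_card (Finset.ssubset_iff_of_subset ?_ |>.2 ⟨x, ?_, ?_⟩)
    · intro u hu
      rw [Finset.mem_filter] at hu ⊢
      exact ⟨hu.1, strLT_trans hu.2 h⟩
    · exact Finset.mem_filter.2 ⟨hx, h⟩
    · simp [strLT_irrefl]
  have hinj : Set.InjOn r S := fun x hx y hy h => by
    rcases strLT_or_eq_or_strLT x y with h' | h' | h'
    · exact absurd h (hlt x hx y h').ne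
    · exact h'
    · exact absurd h (hlt y hy x h').ne'
  have himg : S.image r = Finset.range S.card := by
    refine Finset.eq_of_subset_of_card_le (fun n hn => ?_) (by
      rw [Finset.card_range, Finset.card_image_of_injOn hinj])
    obtain ⟨x, hx, rfl⟩ := Finset.mem_image.1 hn
    refine Finset.mem_range.2 (Finset.card_lt_card (Finset.ssubset_iff_of_subset
      (Finset.filter_subset _ _) |>.2 ⟨x, hx, ?_⟩))
    simp [strLT_irrefl]
  rw [show firstFew k S = S.filter fun x => r x < k from rfl,
    ← Finset.card_image_of_injOn (f := r) (hinj.mono fun x hx => (Finset.mem_filter.1 hx).1),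
    show (S.filter fun x => r x < k).image r = (S.image r).filter (· < k) from
      by rw [Finset.filter_image], himg,
    show (Finset.range S.card).filter (· < k) = Finset.range (min k S.card) from ?_,
    Finset.card_range]
  ext n
  simp [and_comm]

theorem isPolyTime_id : IsPolyTime fun Y => Y :=
  ⟨Turing.idComputableInPolyTime encodeSet, fun _ => inferInstanceAs (Finite Bool)⟩

variable {N : ℕ}

def strEq (x y : Str) : Bool := !strLT x y && !strLT y x

theorem strEq_eq (x y : Str) : strEq x y = decide (x = y) := by
  rw [Bool.eq_iff_iff]
  unfold strEq
  simp only [Bool.and_eq_true, Bool.not_eq_true', decide_eq_true_eq]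
  constructor
  · rintro ⟨h, h'⟩
    simpa [h, h'] using strLT_or_eq_or_strLT x y
  · rintro rfl
    simp [strLT_irrefl]

theorem ev_strEq {d : ℕ} {i j : Fin N} (hij : i ≠ j) :
    Ev d fun _ env => strEq (env i) (env j) :=
  (ev_strLT hij).not.and (ev_strLT hij.symm).not

/-- On `Y`, a selector for pairs from a selector `f` for triples and a string `z`: `z` itself if it
is available, and otherwise at most two strings other than `z` from `f (insert z Y)`. -/
def shrink (f : Finset Str → Finset Str) (z : Str) (Y : Finset Str) : Finset Str :=
  if z ∈ Y then {z} else Y ∩ firstFew 2 ((f (insert z Y)).erase z)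

/-- The definition of `shrink` is written out in the predicate calculus: variable 0 is the string to
be selected, variable 1 holds the constant `z`, and variable 2 is quantified over `Y` or over `f
(insert z Y)`. -/
theorem isPolyTime_shrink {f : Finset Str → Finset Str} (hf : IsPolyTime f)
    (hsub : ∀ Y : Finset Str, Y.Nonempty → f Y ⊆ Y) (z : Str) : IsPolyTime (shrink f z) := by
  have hz : Ev (N := 3) 2 fun ℒ env => decide (1 ≤ (ℒ false).countP fun y =>
      strEq (update env 2 (altIf false y) 2) (update env 2 (altIf false y) 1)) :=
    Ev.count false false 1 2 rfl (ev_strEq (by decide))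
  have hW : Ev (N := 3) 2 fun ℒ env => decide (1 ≤ (ℒ true).countP fun y =>
      strEq (update env 2 (altIf false y) 2) (update env 2 (altIf false y) 0)) :=
    Ev.count true false 1 2 rfl (ev_strEq (by decide))
  have h2 : Ev (N := 3) 2 fun ℒ env => decide (2 ≤ (ℒ true).countP fun y =>
      !(strEq (update env 2 (altIf false y) 2) (update env 2 (altIf false y) 1)) &&
        strLT (update env 2 (altIf false y) 2) (update env 2 (altIf false y) 0)) :=
    Ev.count true false 2 2 rfl ((ev_strEq (by decide)).not.and (ev_strLT (by decide)))
  have h01 : Ev (N := 3) 2 fun _ env => strEq (env 0) (env 1) := ev_strEq (by decide)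
  have key := isPolyTime_select (by norm_num) hf z
    (fun Y => length_encodeSet_le_of_subset (hsub _ (Finset.insert_nonempty z Y))) 0 rfl
    (Ev.const z 1 rfl ((hz.and h01).or ((hz.not.and hW).and (h01.not.and h2.not))))
  convert key using 1
  funext Y
  ext x
  by_cases hzY : z ∈ Y
  · simp [shrink, hzY, countP_sort, strEq_eq, altIf, Finset.filter_eq']
  · simp [shrink, hzY, countP_sort, strEq_eq, altIf, Finset.filter_eq', firstFew, Finset.filter_erase]
    intro _
    rw [show ((f (insert z Y)).filter fun y => ¬y = z ∧ strLT y x) =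
      ((f (insert z Y)).filter fun y => strLT y x).erase z by ext; simp; tauto]
    split_ifs with h <;> simp [h]

/-- The string `z` is fixed advice. The promise with `b ≥ 1` makes `L` nonempty, hence `z ∈ L`; then
`z` is either a correct answer itself or provides the additional member of `L` that the given
selector requires. -/
theorem GC_succ_subset (b : ℕ) (hb : 1 ≤ b) : GC (b + 1) 3 2 ⊆ GC b 2 1 := by
  rintro L ⟨f, hf, hL⟩
  obtain ⟨z, hz⟩ : ∃ z, L.Nonempty → z ∈ L := by
    rcases L.eq_empty_or_nonempty with rfl | ⟨z, hz⟩
    · exact ⟨[], by simp⟩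
    · exact ⟨z, fun _ => hz⟩
  refine ⟨_, isPolyTime_shrink hf (fun Y hY => (hL Y hY).1.1) z, fun Y hY => ?_⟩
  have hne (h : b ≤ (L ∩ (Y : Set Str)).ncard) : z ∈ L := by
    refine hz (Set.Nonempty.left (t := (Y : Set Str)) ?_)
    exact Set.nonempty_of_ncard_ne_zero (by omega)
  unfold shrink
  split_ifs with hzY
  · refine ⟨⟨by simpa using hzY, by simp⟩, fun h => ?_⟩
    rw [Finset.coe_singleton, Set.inter_eq_right.2 (by simpa using hne h), Set.ncard_singleton]
  · obtain ⟨⟨hs, hc⟩, hL'⟩ := hL (insert z Y) (Finset.insert_nonempty z Y)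
    set W := f (insert z Y)
    have hsub : firstFew 2 (W.erase z) ⊆ Y := fun x hx => by
      have := Finset.mem_erase.1 (firstFew_subset _ _ hx)
      exact Finset.mem_of_mem_insert_of_ne (hs this.2) this.1
    have hcard := card_firstFew 2 (W.erase z)
    rw [Finset.inter_eq_right.2 hsub]
    refine ⟨⟨hsub, by omega⟩, fun h => ?_⟩
    set V := firstFew 2 (W.erase z)
    have hVW : V ⊆ W := (firstFew_subset _ _).trans (Finset.erase_subset _ _)
    -- If `z ∈ W`, only `z` is lost, since at most two other strings remain; if not, at most one of
    -- the at most three strings of `W` is cut off.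
    have h1 : (W \ V).card ≤ 1 := by
      have := Finset.card_sdiff_add_card_eq_card hVW
      have := Finset.pred_card_le_card_erase (s := W) (a := z)
      omega
    have h2 : 2 ≤ (L ∩ (W : Set Str)).ncard := by
      refine hL' ?_
      rw [Finset.coe_insert, Set.inter_insert_of_mem (hne h), Set.ncard_insert_of_notMem
        (fun h => hzY h.2) (Y.finite_toSet.inter_of_right _)]
      omega
    have h3 : L ∩ (W : Set Str) ⊆ (L ∩ (V : Set Str)) ∪ ((W \ V : Finset Str) : Set Str) := by
      intro x hx
      by_cases hxV : x ∈ V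
      · exact Or.inl ⟨hx.1, hxV⟩
      · exact Or.inr (by simpa [hxV] using hx.2)
    have h4 := (Set.ncard_le_ncard h3 ((V.finite_toSet.inter_of_right _).union
      (Finset.finite_toSet _))).trans (Set.ncard_union_le _ _)
    rw [Set.ncard_coe_finset] at h4
    omega

theorem GC_mono {b b' : ℕ} (h : b ≤ b') (c d : ℕ) : GC b c d ⊆ GC b' c d := by
  rintro L ⟨f, hf, hL⟩
  exact ⟨f, hf, fun Y hY => ⟨(hL Y hY).1, fun h' => (hL Y hY).2 (h.trans h')⟩⟩

end MultiSel

/-! ### A set in `GC 1 2 1` but not in `GC 3 3 2`: two initial segments -/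

namespace MultiSel

open Function

variable {N : ℕ}

theorem exists_enum_isPolyTime :
    ∃ F : ℕ → Finset Str → Finset Str, ∀ f, IsPolyTime f → ∃ n, F n = f := by
  obtain ⟨F, hF⟩ := countable_isPolyTime.exists_eq_range ⟨_, isPolyTime_id⟩
  exact ⟨F, fun f hf => by rwa [← Set.mem_range, ← hF]⟩

/-- The dictionary order as an automaton. -/
def lexStep (o : Ordering) : Option Bool → Option Bool → Ordering
  | some a, some b => o.then (compare a b)
  | some _, none => o.then .gt
  | none, some _ => o.then .lt
  | none, none => o

def lexLT (x y : Str) : Bool := pairRun lexStep .eq x y = .lt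

theorem pairRun_lexStep (o : Ordering) (x y : Str) :
    pairRun lexStep o x y = .lt ↔ o = .lt ∨ (o = .eq ∧ x < y) := by
  rcases eq_or_ne o .eq with rfl | ho
  · simp only [reduceCtorEq, true_and, false_or]
    induction x generalizing y with
    | nil =>
      cases y with
      | nil => simp [pairRun]
      | cons b y =>
        rw [pairRun, show lexStep .eq none (some b) = .lt from rfl,
          pairRun_absorb fun a b => by cases a <;> cases b <;> rfl]
        simp
    | cons a x ih =>
      cases y with
      | nil =>
        rw [pairRun, show lexStep .eq (some a) none = .gt from rfl,
          pairRun_absorb fun a b => by cases a <;> cases b <;> rfl]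
        simp
      | cons b y =>
        rw [pairRun, List.cons_lt_cons_iff, ← ih]
        cases a <;> cases b <;>
          simp only [lexStep, Ordering.then, compare] <;> simp <;>
          rw [pairRun_absorb fun a b => by cases a <;> cases b <;> rfl] <;> simp
  · rw [pairRun_absorb fun a b => by cases o <;> cases a <;> cases b <;> first | rfl | simp at ho]
    simp [ho]

theorem lexLT_iff (x y : Str) : lexLT x y = true ↔ x < y := by
  simp [lexLT, pairRun_lexStep]

theorem ev_lexLT {d : ℕ} {i j : Fin N} (hij : i ≠ j) : Ev d fun _ env => lexLT (env i) (env j) :=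
  Ev.atom lexStep .eq (fun q => decide (q = .lt)) hij

/-- Equality of the first bits as an automaton. -/
def headStep (q : Option Bool) (a b : Option Bool) : Option Bool :=
  if q.isSome then q else match a, b with
    | some a, some b => some (a == b)
    | _, _ => some false

def headEq (x y : Str) : Bool := pairRun headStep none x y = some true

theorem ev_headEq {d : ℕ} {i j : Fin N} (hij : i ≠ j) : Ev d fun _ env => headEq (env i) (env j) :=
  Ev.atom headStep none (fun q => decide (q = some true)) hij

theorem headEq_iff (x y : Str) : headEq x y = true ↔ ∃ t x' y', x = t :: x' ∧ y = t :: y' := by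
  have habs : ∀ b u v, pairRun headStep (some b) u v = some b := fun b u v =>
    pairRun_absorb (fun _ _ => rfl) u v
  cases x with
  | nil =>
    cases y with
    | nil => simp [headEq, pairRun]
    | cons b y => simp [headEq, pairRun, headStep, habs]
  | cons a x =>
    cases y with
    | nil => simp [headEq, pairRun, headStep, habs]
    | cons b y =>
      simp only [headEq, pairRun, headStep, habs, Option.isSome_none, Bool.false_eq_true, if_false]
      cases a <;> cases b <;> simp

theorem append_lt_append (u a b : Str) : u ++ false :: a < u ++ true :: b := by
  induction u with
  | nil => simp [List.cons_lt_cons_iff]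
  | cons c u ih => simpa using ih

theorem append_le_append_iff (u a b : Str) : u ++ a ≤ u ++ b ↔ a ≤ b := by
  induction u with
  | nil => simp
  | cons c u ih => rw [← ih, ← not_lt, ← not_lt]; simp

theorem nil_le (u : Str) : [] ≤ u := not_lt.1 (by simp)

theorem le_of_prefix {u v : Str} (h : u <+: v) : u ≤ v := by
  obtain ⟨a, rfl⟩ := h
  simpa using (append_le_append_iff u [] a).2 (nil_le a)

/-- The least strings of `Y` among those that begin with `0` and those that begin with `1`. -/
def heads (Y : Finset Str) : Finset Str :=
  Y.filter fun x => (∃ y ∈ Y, headEq y x) ∧ ¬ ∃ y ∈ Y, headEq y x ∧ y < x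

theorem isPolyTime_heads : IsPolyTime heads := by
  have h1 : Ev (N := 2) 1 fun ℒ env => decide (1 ≤ (ℒ false).countP fun y =>
      headEq (update env 1 (altIf false y) 1) (update env 1 (altIf false y) 0)) :=
    Ev.count false false 1 1 rfl (ev_headEq (by decide))
  have h2 : Ev (N := 2) 1 fun ℒ env => decide (1 ≤ (ℒ false).countP fun y =>
      headEq (update env 1 (altIf false y) 1) (update env 1 (altIf false y) 0) &&
        lexLT (update env 1 (altIf false y) 1) (update env 1 (altIf false y) 0)) :=
    Ev.count false false 1 1 rfl ((ev_headEq (by decide)).and (ev_lexLT (by decide)))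
  have key := isPolyTime_select le_rfl isPolyTime_id [] (fun Y => le_rfl) 0 rfl (h1.and h2.not)
  convert key using 1
  funext Y
  ext x
  simp [heads, countP_sort, altIf, Finset.filter_nonempty_iff, lexLT_iff]

theorem card_heads_le (Y : Finset Str) : (heads Y).card ≤ 2 := by
  have := Finset.card_le_card_of_injOn (s := heads Y) (t := {some false, some true}) List.head?
    (fun x hx => by
      obtain ⟨-, ⟨y, -, hy⟩, -⟩ := Finset.mem_filter.1 hx
      obtain ⟨t, x', y', -, rfl⟩ := (headEq_iff _ _).1 hy
      cases t <;> simp)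
    (fun x hx y hy hxy => by
      obtain ⟨hx1, ⟨u, -, hu⟩, hx2⟩ := Finset.mem_filter.1 hx
      obtain ⟨hy1, ⟨v, -, hv⟩, hy2⟩ := Finset.mem_filter.1 hy
      obtain ⟨t, _, x', -, rfl⟩ := (headEq_iff _ _).1 hu
      obtain ⟨s, _, y', -, rfl⟩ := (headEq_iff _ _).1 hv
      obtain rfl : t = s := by simpa using hxy
      push Not at hx2 hy2
      exact le_antisymm (hx2 _ hy1 ((headEq_iff _ _).2 ⟨t, _, _, rfl, rfl⟩) |> fun h => h)
        (hy2 _ hx1 ((headEq_iff _ _).2 ⟨t, _, _, rfl, rfl⟩) |> fun h => h))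
  exact this.trans (Finset.card_le_two)

/-- The strings `t :: x` with `x` below the infinite word that is the limit of the words
`w n t`. -/
def cuts (w : ℕ → Bool → Str) : Set Str := {y | ∃ t x n, y = t :: x ∧ x ≤ w n t}

/-- On each side the set is downward closed in the dictionary order, so if it contains some input
then it contains the least input with the same first bit. Nothing about `w` is needed. -/
theorem isSelector_heads (w : ℕ → Bool → Str) : IsSelector 1 2 1 (cuts w) heads := by
  refine fun Y _ => ⟨⟨Finset.filter_subset _ _, card_heads_le Y⟩, fun h => ?_⟩
  obtain ⟨_, ⟨t, x, n, rfl, hx⟩, hY⟩ := Set.nonempty_of_ncard_ne_zero (by omega :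
    (cuts w ∩ (Y : Set Str)).ncard ≠ 0)
  obtain ⟨m, hm, hmin⟩ := Finset.exists_min_image (Y.filter fun y => headEq y (t :: x)) id
    ⟨t :: x, Finset.mem_filter.2 ⟨hY, (headEq_iff _ _).2 ⟨t, _, _, rfl, rfl⟩⟩⟩
  obtain ⟨hmY, hm⟩ := Finset.mem_filter.1 hm
  obtain ⟨s, m', _, rfl, h'⟩ := (headEq_iff _ _).1 hm
  obtain ⟨rfl, rfl⟩ := List.cons_eq_cons.1 h'
  have hle : t :: m' ≤ t :: x := hmin _ (Finset.mem_filter.2 ⟨hY, (headEq_iff _ _).2 ⟨t, _, _, rfl, rfl⟩⟩)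
  refine (Set.ncard_pos ((heads Y).finite_toSet.inter_of_right _)).2 ⟨t :: m', ⟨t, m', n, rfl, ?_⟩,
    Finset.mem_filter.2 ⟨hmY, ⟨_, hmY, (headEq_iff _ _).2 ⟨t, _, _, rfl, rfl⟩⟩, ?_⟩⟩
  · exact le_trans ((append_le_append_iff [t] m' x).1 hle) hx
  · rintro ⟨y, hy, h1, h2⟩
    refine absurd h2 (not_lt.2 (hmin y (Finset.mem_filter.2 ⟨hy, ?_⟩)))
    obtain ⟨s, y', _, rfl, h'⟩ := (headEq_iff _ _).1 h1
    obtain ⟨rfl, rfl⟩ := List.cons_eq_cons.1 h'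
    exact (headEq_iff _ _).2 ⟨t, _, _, rfl, rfl⟩

/-- Three strings above every extension of `u ++ [false]` and below `u ++ [true, true]`. -/
def three (t : Bool) (u : Str) : Finset Str :=
  {t :: (u ++ [true]), t :: (u ++ [true, false]), t :: (u ++ [true, false, false])}

theorem card_three (t : Bool) (u : Str) : (three t u).card = 3 := by
  simp [three, Finset.card_insert_of_notMem]

theorem mem_three_iff {t : Bool} {u y : Str} (h : y ∈ three t u) :
    ∃ a, y = t :: (u ++ true :: a) ∧ true :: a ≤ [true, true] := by
  simp only [three, Finset.mem_insert, Finset.mem_singleton] at h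
  rcases h with rfl | rfl | rfl
  · exact ⟨[], rfl, by decide⟩
  · exact ⟨[false], rfl, by decide⟩
  · exact ⟨[false, false], rfl, by decide⟩

def threes (w : Bool → Str) : Finset Str := three false (w false) ∪ three true (w true)

/-- The first bit for which `f` selects at most one of its three strings, if there is one. -/
def neglected (f : Finset Str → Finset Str) (w : Bool → Str) : Bool :=
  !decide ((f (threes w) ∩ three false (w false)).card ≤ 1)

/-- Appending `11` lifts the cut above the three strings of the neglected side; appending `0` keeps
it below those of the other side at all later stages. -/
def cutPath (F : ℕ → Finset Str → Finset Str) : ℕ → Bool → Str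
  | 0, _ => []
  | n + 1, t => cutPath F n t ++
    if t = neglected (F n) (cutPath F n) then [true, true] else [false]

theorem cutPath_prefix (F : ℕ → Finset Str → Finset Str) (t : Bool) {m n : ℕ} (h : m ≤ n) :
    cutPath F m t <+: cutPath F n t := by
  induction n, h using Nat.le_induction with
  | base => exact List.prefix_rfl
  | succ n _ ih => exact ih.trans (List.prefix_append _ _)

theorem GC_one_two_one_not_subset : ¬ GC 1 2 1 ⊆ GC 3 3 2 := by
  obtain ⟨F, hF⟩ := exists_enum_isPolyTime
  intro hsub
  obtain ⟨f, hf, hL⟩ := hsub ⟨heads, isPolyTime_heads, isSelector_heads (cutPath F)⟩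
  obtain ⟨n, rfl⟩ := hF f hf
  set w := cutPath F n with hw
  set t := neglected (F n) w with ht
  have hin : (three t (w t) : Set Str) ⊆ cuts (cutPath F) := fun y hy => by
    obtain ⟨a, rfl, ha⟩ := mem_three_iff hy
    refine ⟨t, _, n + 1, rfl, ?_⟩
    rw [cutPath, if_pos rfl]
    exact (append_le_append_iff _ _ _).2 ha
  -- On the other side every word of the path is at most some extension of `w s ++ [false]`, whereas
  -- the three strings extend `w s ++ [true]`.
  have hout : ∀ s, s ≠ t → ∀ y ∈ three s (w s), y ∉ cuts (cutPath F) := by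
    rintro s hs y hy ⟨s', x, m, h, hm⟩
    obtain ⟨a, rfl, ha⟩ := mem_three_iff hy
    obtain ⟨rfl, rfl⟩ := List.cons_eq_cons.1 h
    have h1 := hm.trans (le_of_prefix (cutPath_prefix F s (le_max_left m (n + 1))))
    obtain ⟨b, hb⟩ := cutPath_prefix F s (le_max_right m (n + 1))
    rw [← hb, cutPath, if_neg hs] at h1
    refine absurd h1 (not_le.2 ?_)
    simpa using append_lt_append (w s) b a
  have hsubset : three t (w t) ⊆ threes w := by
    cases t
    · exact Finset.subset_union_left
    · exact Finset.subset_union_right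
  obtain ⟨⟨h1, h2⟩, h3⟩ := hL (threes w) (by simp [threes, three])
  have h4 : 3 ≤ (cuts (cutPath F) ∩ (threes w : Set Str)).ncard := by
    rw [← card_three t (w t), ← Set.ncard_coe_finset]
    exact Set.ncard_le_ncard (Set.subset_inter hin (by exact_mod_cast hsubset))
      ((threes w).finite_toSet.inter_of_right _)
  -- The two triples are disjoint, so two selected strings in each would exceed the bound of three.
  have h5 : (F n (threes w) ∩ three t (w t)).card ≤ 1 := by
    by_cases hc : (F n (threes w) ∩ three false (w false)).card ≤ 1
    · have : t = false := by simp [ht, neglected, hc]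
      rwa [this]
    · have : t = true := by simp [ht, neglected, hc]
      rw [this]
      have hd : Disjoint (F n (threes w) ∩ three false (w false))
          (F n (threes w) ∩ three true (w true)) := by
        rw [Finset.disjoint_left]
        intro y hy hy'
        obtain ⟨a, rfl, -⟩ := mem_three_iff (Finset.mem_inter.1 hy).2
        obtain ⟨b, h, -⟩ := mem_three_iff (Finset.mem_inter.1 hy').2
        simp at h
      have := Finset.card_le_card (Finset.union_subset (Finset.inter_subset_left)
        (Finset.inter_subset_left) : F n (threes w) ∩ three false (w false) ∪
          F n (threes w) ∩ three true (w true) ⊆ F n (threes w))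
      rw [Finset.card_union_of_disjoint hd] at this
      omega
  have h6 : cuts (cutPath F) ∩ (F n (threes w) : Set Str) ⊆
      (F n (threes w) ∩ three t (w t) : Finset Str) := by
    rintro y ⟨hy, hy'⟩
    have hy' : y ∈ F n (threes w) := hy'
    have : ∃ s, y ∈ three s (w s) := by
      rcases Finset.mem_union.1 (h1 hy') with h | h
      exacts [⟨_, h⟩, ⟨_, h⟩]
    obtain ⟨s, hs⟩ := this
    obtain rfl : s = t := by
      by_contra hst
      exact hout s hst y hs hy
    exact Finset.mem_coe.2 (Finset.mem_inter.2 ⟨hy', hs⟩)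
  have h7 := Set.ncard_le_ncard h6 (Finset.finite_toSet _)
  rw [Set.ncard_coe_finset] at h7
  have := h3 h4
  omega

end MultiSel

/-! ### A set in `GC 3 3 2` but not in `GC 1 2 1`: initial segments with exceptions -/

namespace MultiSel

open Function

variable {N : ℕ}

/-- Membership in the set coded by `s`: the strings below `s` in the dictionary order, except for
`v ++ [false]` if `s` extends `v ++ [true]` but not `v ++ [true, true]`. -/
def mem : Str → Str → Bool
  | [], _ => true
  | _ :: _, [] => false
  | a :: x, b :: s =>
    if a = b then mem x s else if a then false else !x.isEmpty || s.head? == some true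

/-- The automaton for `mem`: `none` while the strings agree, `some none` just after a `0` opposite
to a `1`, and `some (some b)` when the answer `b` is known. -/
def memStep : Option (Option Bool) → Option Bool → Option Bool → Option (Option Bool)
  | none, none, _ => some (some true)
  | none, some _, none => some (some false)
  | none, some a, some b => if a = b then none else if a then some (some false) else some none
  | some none, some _, _ => some (some true)
  | some none, none, b => some (some (b == some true))
  | some (some c), _, _ => some (some c)

theorem pairRun_memStep (x s : Str) :
    pairRun memStep none x s ∈ ({none, some (some true)} : Set (Option (Option Bool))) ↔
      mem x s = true := by
  have habs : ∀ b u v, pairRun memStep (some (some b)) u v = some (some b) := fun b u v =>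
    pairRun_absorb (fun _ _ => rfl) u v
  induction x generalizing s with
  | nil => cases s <;> simp [pairRun, memStep, habs, mem]
  | cons a x ih =>
    cases s with
    | nil => simp [pairRun, memStep, habs, mem]
    | cons b s =>
      by_cases hab : a = b
      · simp [pairRun, memStep, mem, hab, ih]
      · cases a
        · cases x <;> rcases s with - | ⟨- | -, s⟩ <;> simp [pairRun, memStep, mem, hab, habs]
        · simp [pairRun, memStep, mem, hab, habs]

theorem ev_mem {d : ℕ} {i j : Fin N} (hij : i ≠ j) : Ev d fun _ env => mem (env i) (env j) := by
  classical
  convert Ev.atom memStep none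
    (fun q => decide (q ∈ ({none, some (some true)} : Set (Option (Option Bool))))) hij using 3
    with _ env
  rw [Bool.eq_iff_iff, decide_eq_true_iff, pairRun_memStep]

theorem cons_le_cons_iff_or (a b : Bool) (x y : Str) :
    a :: x ≤ b :: y ↔ (a = false ∧ b = true) ∨ (a = b ∧ x ≤ y) := by
  rw [← not_lt, List.cons_lt_cons_iff, ← not_lt]
  cases a <;> cases b <;> simp

theorem not_cons_le_nil (a : Bool) (x : Str) : ¬ a :: x ≤ [] := not_le.2 (by simp)

/-- Membership of `x` depends on one bit of `s` beyond the length of `x`, the one that distinguishes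
`v10` from `v11`; hence the strict inequality. -/
theorem mem_append {x s : Str} (t : Str) (h : x.length < s.length) : mem x (s ++ t) = mem x s := by
  induction x generalizing s with
  | nil => rfl
  | cons a x ih =>
    cases s with
    | nil => simp at h
    | cons b s =>
      cases s with
      | nil => simp at h
      | cons e s =>
        have := ih (s := e :: s) (by simpa using h)
        rw [List.cons_append] at this
        simp [mem, this]

theorem mem_append_append (u x s : Str) : mem (u ++ x) (u ++ s) = mem x s := by
  induction u with
  | nil => rfl
  | cons c u ih => simpa [mem] using ih

theorem le_of_mem {x s : Str} (h : mem x s) : x ≤ s := by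
  induction x generalizing s with
  | nil => exact nil_le s
  | cons a x ih =>
    cases s with
    | nil => simp [mem] at h
    | cons b s =>
      rw [cons_le_cons_iff_or]
      cases a <;> cases b <;> simp [mem] at h ⊢ <;> exact ih h

/-- A string of the set of `c` is below `c`, hence below `s`, so `s` can exclude it only as an
exception `v0`, with `s` extending `v1` but not `v11`. If `c` extended `v1` as well, then `c ≤ s`
would make `v0` an exception for `c` too. So `c` extends `v0`, and `v` is the longest common prefix
of `c` and `s`. -/
theorem mem_sdiff_unique {c s x y : Str} (hcs : c ≤ s) (hx : mem x c) (hxs : ¬ mem x s)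
    (hy : mem y c) (hys : ¬ mem y s) : x = y := by
  induction c generalizing s x y with
  | nil => cases x <;> simp [mem] at hx hxs
  | cons b c ih =>
    rcases x with - | ⟨a, x⟩
    · simp [mem] at hxs
    rcases y with - | ⟨a', y⟩
    · simp [mem] at hys
    rcases s with - | ⟨e, s⟩
    · exact absurd hcs (not_cons_le_nil _ _)
    rw [cons_le_cons_iff_or] at hcs
    -- This treats an exception right at the current bit: if `c` goes through `11` there, so does
    -- the larger `s`.
    have aux : c ≤ s → c.head? = some true → s.head? = some true := by
      intro h h'
      rcases c with - | ⟨- | -, c⟩ <;> rcases s with - | ⟨- | -, s⟩ <;> simp at h' ⊢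
      · exact not_cons_le_nil _ _ h
      · rw [cons_le_cons_iff_or] at h
        simp at h
    rcases hcs with hcs | ⟨rfl, hcs⟩
    · obtain ⟨rfl, rfl⟩ := hcs
      cases a <;> cases a' <;> simp_all [mem]
    · have := @ih s x y hcs
      have := aux hcs
      cases b <;> cases a <;> cases a' <;> simp_all [mem]

theorem alt_cons {a : Bool} {x : Str} (h : x ≠ []) : alt (a :: x) = a :: alt x := by
  cases x with
  | nil => exact absurd rfl h
  | cons b x => rfl

theorem head?_of_le {c : Str} (h : [true, true] ≤ true :: c) : c.head? = some true := by
  rw [cons_le_cons_iff_or] at h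
  rcases c with - | ⟨b, c⟩
  · exact absurd (by simpa using h) (not_cons_le_nil _ _)
  · rw [cons_le_cons_iff_or] at h
    cases b <;> simp at h ⊢

/-- For `x = v0` the string `alt x = v11` is the point from which on `v0` is no longer an exception.
-/
theorem mem_of_alt_le {x c : Str} (h : x ≤ c) (h' : alt x ≤ c) : mem x c := by
  induction x generalizing c with
  | nil => rfl
  | cons a x ih =>
    rcases c with - | ⟨e, c⟩
    · exact absurd h (not_cons_le_nil _ _)
    rcases eq_or_ne x [] with rfl | hx
    · cases a <;> cases e <;> simp [mem, cons_le_cons_iff_or] at h ⊢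
      exact head?_of_le h'
    · rw [alt_cons hx] at h'
      have := @ih c
      cases a <;> cases e <;> simp_all [mem, cons_le_cons_iff_or]

/-- Going down from `s` to `c` can lose `x` only by passing below `x` or below `alt x`; the
hypotheses forbid both. If `x` is a prefix of `s`, then `c`, lying between them, extends `x` too.
Otherwise `x` has `0` where it first differs from `s`, and either `x` ends there and `s` continues
with `11`, or `alt x` has the same `0`. In both cases `alt x ≤ s`. -/
theorem mem_of_mem_of_le {x s c : Str} (hx : mem x s) (hxc : x ≤ c)
    (halt : alt x ≤ s → alt x ≤ c) (hcs : c ≤ s) : mem x c := by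
  induction x generalizing s c with
  | nil => rfl
  | cons a x ih =>
    rcases c with - | ⟨e, c⟩
    · exact absurd hxc (not_cons_le_nil _ _)
    rcases s with - | ⟨b, s⟩
    · exact absurd hcs (not_cons_le_nil _ _)
    by_cases hab : a = b
    · obtain rfl : a = e := by
        rw [cons_le_cons_iff_or] at hxc hcs
        subst hab
        cases a <;> cases e <;> simp_all
      subst hab
      rw [cons_le_cons_iff_or] at hxc hcs
      rcases eq_or_ne x [] with rfl | hxe
      · simp [mem]
      · rw [alt_cons hxe, cons_le_cons_iff_or, cons_le_cons_iff_or] at halt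
        simp only [mem, if_true] at hx ⊢
        exact ih hx (by simpa using hxc) (by simpa using halt) (by simpa using hcs)
    · refine mem_of_alt_le hxc (halt ?_)
      obtain ⟨rfl, rfl⟩ : a = false ∧ b = true := by cases a <;> cases b <;> simp_all [mem]
      rcases eq_or_ne x [] with rfl | hxe
      · rcases s with - | ⟨- | -, s⟩ <;> simp [mem] at hx
        exact (append_le_append_iff [true, true] [] s).2 (nil_le s)
      · rw [alt_cons hxe, cons_le_cons_iff_or]
        simp

/-- The members of `Y` in the set coded by `c`. -/
def below (c : Str) (Y : Finset Str) : Finset Str := Y.filter fun x => mem x c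

/-- `c` is the least of the candidates `y` and `alt y` with `y ∈ Y` that code sets with at least
three members of `Y`. -/
structure IsChoice (Y : Finset Str) (y : Str) (tr : Bool) : Prop where
  three_le : 3 ≤ (below (altIf tr y) Y).card
  least : ∀ y' ∈ Y, ∀ tr', 3 ≤ (below (altIf tr' y') Y).card → altIf tr y ≤ altIf tr' y'

open Classical in
/-- Three strings from the set coded by the least candidate. -/
noncomputable def choose (Y : Finset Str) : Finset Str :=
  Y.filter fun x => ∃ y ∈ Y, ∃ tr, IsChoice Y y tr ∧ x ∈ firstFew 3 (below (altIf tr y) Y)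

theorem choose_eq {Y : Finset Str} {y : Str} (hy : y ∈ Y) {tr : Bool} (h : IsChoice Y y tr) :
    choose Y = firstFew 3 (below (altIf tr y) Y) := by
  classical
  ext x
  rw [choose, Finset.mem_filter]
  constructor
  · rintro ⟨-, y', hy', tr', h', hx⟩
    rwa [le_antisymm (h.least y' hy' tr' h'.three_le) (h'.least y hy tr h.three_le)]
  · exact fun hx => ⟨Finset.filter_subset _ _ (firstFew_subset _ _ hx), y, hy, tr, h, hx⟩

theorem exists_isChoice {Y : Finset Str} {y : Str} (hy : y ∈ Y) {tr : Bool}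
    (h : 3 ≤ (below (altIf tr y) Y).card) : ∃ y' ∈ Y, ∃ tr', IsChoice Y y' tr' := by
  obtain ⟨⟨y', tr'⟩, h1, h2⟩ := Finset.exists_min_image
    ((Y ×ˢ Finset.univ).filter fun p : Str × Bool => 3 ≤ (below (altIf p.2 p.1) Y).card)
    (fun p => altIf p.2 p.1) ⟨(y, tr), by simpa using ⟨hy, h⟩⟩
  simp only [Finset.mem_filter, Finset.mem_product, Finset.mem_univ, and_true] at h1 h2
  exact ⟨y', h1.1, tr', h1.2, fun u hu tr hu' => h2 (u, tr) ⟨hu, hu'⟩⟩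

/-- Variable 0 is the string to be selected, variable 1 the chosen candidate, variable 2 a competing
candidate or a string counted below the chosen one, and variable 3 a string counted below the
competitor. A candidate is quantified twice, as an input `y` and as `alt y`. -/
theorem isPolyTime_choose : IsPolyTime choose := by
  have hgood2 : Ev (N := 4) 2 fun ℒ env => decide (3 ≤ (ℒ false).countP fun y =>
      mem (update env 2 (altIf false y) 2) (update env 2 (altIf false y) 1)) :=
    Ev.count false false 3 2 rfl (ev_mem (by decide))
  have hgood3 : Ev (N := 4) 3 fun ℒ env => decide (3 ≤ (ℒ false).countP fun y =>
      mem (update env 3 (altIf false y) 3) (update env 3 (altIf false y) 2)) :=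
    Ev.count false false 3 3 rfl (ev_mem (by decide))
  have hlt : Ev (N := 4) 3 fun ℒ env => lexLT (env 2) (env 1) := ev_lexLT (by decide)
  have hfew : Ev (N := 4) 2 fun ℒ env => decide (3 ≤ (ℒ false).countP fun y =>
      mem (update env 2 (altIf false y) 2) (update env 2 (altIf false y) 1) &&
        strLT (update env 2 (altIf false y) 2) (update env 2 (altIf false y) 0)) :=
    Ev.count false false 3 2 rfl ((ev_mem (by decide)).and (ev_strLT (by decide)))
  have hmem : Ev (N := 4) 2 fun ℒ env => mem (env 0) (env 1) := ev_mem (by decide)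
  have hall := (hgood2.and (((Ev.count false false 1 2 rfl (hgood3.and hlt)).or
    (Ev.count false true 1 2 rfl (hgood3.and hlt))).not)).and (hmem.and hfew.not)
  have key := isPolyTime_select (by norm_num) isPolyTime_id [] (fun Y => le_rfl) 0 rfl
    ((Ev.count false false 1 1 rfl hall).or (Ev.count false true 1 1 rfl hall))
  have hch : ∀ Y y tr, IsChoice Y y tr ↔ 3 ≤ (below (altIf tr y) Y).card ∧
      ∀ y' ∈ Y, ∀ tr', 3 ≤ (below (altIf tr' y') Y).card → altIf tr y ≤ altIf tr' y' :=
    fun Y y tr => ⟨fun h => ⟨h.1, h.2⟩, fun h => ⟨h.1, h.2⟩⟩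
  convert key using 1
  funext Y
  ext x
  simp [choose, hch, countP_sort, Finset.filter_nonempty_iff, lexLT_iff,
    firstFew, below, Finset.filter_filter, altIf, and_assoc]
  intro hx
  simp only [hx, true_and, forall₂_and, and_assoc, and_or_left, exists_or]

/-- The word `s` may vary with `Y` and is unknown to the selector. The largest candidate below `s`
captures all members of `L` in `Y`, hence at least three inputs; so the least candidate that
captures three is at most `s`, and at most one of the three chosen strings can be wrong. -/
theorem isSelector_choose {L : Set Str}
    (hL : ∀ Y : Finset Str, ∃ s, ∀ x ∈ Y, x ∈ L ↔ mem x s = true) : IsSelector 3 3 2 L choose := by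
  classical
  intro Y _
  have hc : (choose Y).card ≤ 3 := by
    by_cases h : ∃ y ∈ Y, ∃ tr, IsChoice Y y tr
    · obtain ⟨y, hy, tr, h⟩ := h
      rw [choose_eq hy h, card_firstFew]
      omega
    · rw [choose, Finset.filter_false_of_mem]
      · simp
      · rintro x - ⟨y, hy, tr, h', -⟩
        exact h ⟨y, hy, tr, h'⟩
  refine ⟨⟨Finset.filter_subset _ _, hc⟩, fun h => ?_⟩
  obtain ⟨s, hs⟩ := hL Y
  have hLY : L ∩ (Y : Set Str) = (below s Y : Finset Str) := by
    ext x
    simp only [below, Set.mem_inter_iff, Finset.coe_filter, Set.mem_ofPred_eq, Finset.mem_coe]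
    exact ⟨fun h => ⟨h.2, (hs x h.2).1 h.1⟩, fun h => ⟨(hs x h.1).2 h.2, h.1⟩⟩
  rw [hLY, Set.ncard_coe_finset] at h
  obtain ⟨x₀, hx₀⟩ := Finset.card_pos.1 (by omega : 0 < (below s Y).card)
  obtain ⟨hx₀Y, hx₀s⟩ := Finset.mem_filter.1 hx₀
  -- Any member `x₀` of the set is itself a candidate below `s`, so the maximum exists.
  obtain ⟨⟨y, tr⟩, h1, h2⟩ := Finset.exists_max_image
    ((Y ×ˢ Finset.univ).filter fun p : Str × Bool => altIf p.2 p.1 ≤ s)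
    (fun p => altIf p.2 p.1) ⟨(x₀, false), by
      rw [Finset.mem_filter, Finset.mem_product]
      exact ⟨⟨hx₀Y, Finset.mem_univ _⟩, le_of_mem hx₀s⟩⟩
  simp only [Finset.mem_filter, Finset.mem_product, Finset.mem_univ, and_true] at h1 h2
  have hsub : below s Y ⊆ below (altIf tr y) Y := fun x hx => by
    obtain ⟨hxY, hxs⟩ := Finset.mem_filter.1 hx
    exact Finset.mem_filter.2 ⟨hxY, mem_of_mem_of_le hxs (h2 (x, false) ⟨hxY, le_of_mem hxs⟩)
      (fun h => h2 (x, true) ⟨hxY, h⟩) h1.2⟩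
  have h3 := h.trans (Finset.card_le_card hsub)
  obtain ⟨y', hy', tr', hch⟩ := exists_isChoice h1.1 h3
  have hle : altIf tr' y' ≤ s := (hch.least _ h1.1 _ h3).trans h1.2
  have hcard := card_firstFew 3 (below (altIf tr' y') Y)
  have hthree := hch.three_le
  rw [choose_eq hy' hch]
  set V := firstFew 3 (below (altIf tr' y') Y)
  have hV : ∀ x ∈ V, x ∈ Y ∧ mem x (altIf tr' y') := fun x hx =>
    Finset.mem_filter.1 (firstFew_subset _ _ hx)
  -- All of `V` lies in the set of a candidate that is at most `s`.
  have h4 : (V.filter fun x => ¬ mem x s).card ≤ 1 := by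
    refine Finset.card_le_one.2 fun x hx x' hx' => ?_
    rw [Finset.mem_filter] at hx hx'
    exact mem_sdiff_unique hle (hV x hx.1).2 hx.2 (hV x' hx'.1).2 hx'.2
  have h5 := Finset.card_filter_add_card_filter_not (s := V) fun x => mem x s = true
  have h6 : L ∩ (V : Set Str) = (V.filter fun x => mem x s : Finset Str) := by
    ext x
    simp only [Set.mem_inter_iff, Finset.coe_filter, Set.mem_ofPred_eq, Finset.mem_coe]
    exact ⟨fun h => ⟨h.2, (hs x (hV x h.2).1).1 h.1⟩, fun h => ⟨(hs x (hV x h.1).1).2 h.2, h.1⟩⟩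
  rw [h6, Set.ncard_coe_finset]
  omega

/-- Three strings of which exactly `u ++ a` belongs to a set coded by an extension of
`u ++ a`. -/
def fork (u : Str) : Finset Str := {u ++ [false], u ++ [true, false, false], u ++ [true, false, true, false]}

theorem card_fork (u : Str) : (fork u).card = 3 := by
  simp [fork, Finset.card_insert_of_notMem]

open Classical in
/-- The word that runs through a string of the fork that `F n` omits at stage `n`. -/
noncomputable def forkPath (F : ℕ → Finset Str → Finset Str) : ℕ → Str
  | 0 => []
  | n + 1 => if h : ∃ x ∈ fork (forkPath F n), x ∉ F n (fork (forkPath F n)) then h.choose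
      else forkPath F n ++ [false]

/-- The fork is `u0`, `u100`, `u1010`. Larger strings are never members; `u0` is an exception for
words through `u10`, and `u100` is one for words through `u1010`. -/
theorem mem_fork_of_mem (u : Str) {x y : Str} (hx : x ∈ fork u) (hy : y ∈ fork u) (t : Str)
    (h : mem x (y ++ t)) : x = y := by
  simp only [fork, Finset.mem_insert, Finset.mem_singleton] at hx hy
  rcases hx with rfl | rfl | rfl <;> rcases hy with rfl | rfl | rfl <;>
    simp [List.append_assoc, mem_append_append, mem] at h ⊢

theorem forkPath_succ_mem (F : ℕ → Finset Str → Finset Str) (n : ℕ) :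
    forkPath F (n + 1) ∈ fork (forkPath F n) := by
  rw [forkPath]
  split_ifs with h
  · exact h.choose_spec.1
  · simp [fork]

theorem forkPath_prefix (F : ℕ → Finset Str → Finset Str) {m n : ℕ} (h : m ≤ n) :
    forkPath F m <+: forkPath F n := by
  induction n, h using Nat.le_induction with
  | base => exact List.prefix_rfl
  | succ n _ ih =>
    have := forkPath_succ_mem F n
    simp only [fork, Finset.mem_insert, Finset.mem_singleton] at this
    refine ih.trans ?_
    rcases this with h | h | h <;> rw [h] <;> exact List.prefix_append _ _

theorem le_length_forkPath (F : ℕ → Finset Str → Finset Str) (n : ℕ) :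
    n ≤ (forkPath F n).length := by
  induction n with
  | zero => omega
  | succ n ih =>
    have := forkPath_succ_mem F n
    simp only [fork, Finset.mem_insert, Finset.mem_singleton] at this
    rcases this with h | h | h <;> rw [h] <;> simp <;> omega

/-- The set coded by the limit of the words `w n`. -/
def limitSet (w : ℕ → Str) : Set Str := {x | mem x (w (x.length + 1))}

/-- Every stage lengthens the path, so stage `x.length + 1` already decides `x` for good. -/
theorem mem_limitSet_iff (F : ℕ → Finset Str → Finset Str) {x : Str} {n : ℕ} (h : x.length < n) :
    x ∈ limitSet (forkPath F) ↔ mem x (forkPath F n) := by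
  obtain ⟨t, ht⟩ := forkPath_prefix F (Nat.succ_le_of_lt h)
  rw [← ht, mem_append _ (Nat.lt_of_succ_le (le_length_forkPath F _))]
  rfl

theorem GC_three_three_two_not_subset : ¬ GC 3 3 2 ⊆ GC 1 2 1 := by
  obtain ⟨F, hF⟩ := exists_enum_isPolyTime
  intro hsub
  obtain ⟨f, hf, hL⟩ := hsub (a := limitSet (forkPath F)) ⟨choose, isPolyTime_choose,
    isSelector_choose fun Y => ⟨forkPath F (Y.sup List.length + 1), fun x hx =>
      mem_limitSet_iff F (Nat.lt_succ_of_le (Finset.le_sup (f := List.length) hx))⟩⟩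
  obtain ⟨n, rfl⟩ := hF f hf
  set u := forkPath F n with hu
  obtain ⟨⟨h1, h2⟩, h3⟩ := hL (fork u) (by simp [fork])
  -- The fork has three strings and only two may be returned, so the path runs through an omitted
  -- one, which becomes the only member of the fork.
  have hex : ∃ x ∈ fork u, x ∉ F n (fork u) := by
    by_contra! h
    have := Finset.card_le_card h
    rw [card_fork] at this
    omega
  have hnot : forkPath F (n + 1) ∉ F n (fork u) := by
    rw [forkPath, dif_pos hex]
    exact hex.choose_spec.2
  have hiff : ∀ x ∈ fork u, x ∈ limitSet (forkPath F) ↔ x = forkPath F (n + 1) := by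
    intro x hx
    obtain ⟨t, ht⟩ := forkPath_prefix F (le_max_left (n + 1) (x.length + 1))
    rw [mem_limitSet_iff F (le_max_right (n + 1) (x.length + 1)), ← ht]
    refine ⟨mem_fork_of_mem u hx (forkPath_succ_mem F n) t, ?_⟩
    rintro rfl
    simpa [mem] using mem_append_append (forkPath F (n + 1)) [] t
  have h4 : 1 ≤ (limitSet (forkPath F) ∩ (fork u : Set Str)).ncard :=
    (Set.ncard_pos ((fork u).finite_toSet.inter_of_right _)).2
      ⟨_, (hiff _ (forkPath_succ_mem F n)).2 rfl, forkPath_succ_mem F n⟩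
  obtain ⟨x, hx, hx'⟩ := Set.nonempty_of_ncard_ne_zero (by have := h3 h4; omega :
    (limitSet (forkPath F) ∩ (F n (fork u) : Set Str)).ncard ≠ 0)
  exact hnot ((hiff x (h1 hx')).1 hx ▸ hx')

end MultiSel

theorem mainTheorem10 :
    MultiSel.GC 2 3 2 ⊂ MultiSel.GC 1 2 1 ∧
    (¬ MultiSel.GC 3 3 2 ⊆ MultiSel.GC 1 2 1 ∧ ¬ MultiSel.GC 1 2 1 ⊆ MultiSel.GC 3 3 2) ∧
    MultiSel.GC 3 3 2 ⊂ MultiSel.GC 2 2 1 := by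
  have hA := MultiSel.GC_one_two_one_not_subset
  -- Each reverse inclusion would place `GC 1 2 1` inside `GC 3 3 2`: the first through `GC 2 3 2 ⊆
  -- GC 3 3 2`, the other through `GC 1 2 1 ⊆ GC 2 2 1`.
  refine ⟨⟨MultiSel.GC_succ_subset 1 le_rfl, fun h => hA ?_⟩,
    ⟨MultiSel.GC_three_three_two_not_subset, hA⟩,
    MultiSel.GC_succ_subset 2 (by norm_num), fun h => hA ?_⟩
  · exact h.trans (MultiSel.GC_mono (by norm_num) 3 2)
  · exact (MultiSel.GC_mono (by norm_num) 2 1).trans h
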